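/- \textbf{Conventions.} Let $\mathbb B$ be a separable real Banach space with norm $\lVert\cdot\rVert$. For $1<r\le 2$, $\mathbb B$ is called $r$-smooth if there is an equivalent norm $\lVert\cdot\rVert'$ on $\mathbb B$ with \[\sup_{t>0}\ \sup_{\lVert x\rVert'=\lVert y\rVert'=1}\frac{\lVert x+ty\rVert'+\lVert x-ty\rVert'-2}{t^r}<\infty .\] For integers $m\ge 2$ and $n\ge 0$ let $\operatorname{Inc}^m_n=\{(i_1,\dots,i_m)\in\mathbb Z^m: 1\le i_1<\dots<i_m\le n\}$. Let $(\xi_i)_{i\in\mathbb Z}$ be an i.i.d. sequence of random variables with values in a measurable space $(S,\mathcal S)$. A measurable function $h\colon S^m\to\mathbb B$ is symmetric if $h(x_{\sigma(1)},\dots,x_{\sigma(m)})=h(x_1,\dots,x_m)$ for all permutations $\sigma$ and all $x_1,\dots,x_m\in S$. For $1\le d\le m$, a symmetric $h$ is degenerate of order $d$ with respect to $(\xi_i)$ if $h(\xi_1,\dots,\xi_m)$ is integrable, \[\mathbb E[h(\xi_1,\dots,\xi_m)\mid \xi_1,\dots,\xi_{d-1}]=0\ \text{a.s.}\quad\text{and}\quad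 \mathbb E\bigl\lVert \mathbb E[h(\xi_1,\dots,\xi_m)\mid \xi_1,\dots,\xi_d]\bigr\rVert\neq 0,\] where for $d=1$ the first condition reads $\mathbb E[h(\xi_1,\dots,\xi_m)]=0$. \textbf{Theorem.} Let $\mathbb B$ be a separable $r$-smooth Banach space with $1<r\le 2$, let $m\ge 2$ be an integer, and let $1<p\le r$ and $q\ge p$ be real. There is a constant $C=C(\mathbb B,m,p,q)>0$, depending only on $\mathbb B$, $m$, $p$ and $q$, such that the following holds. Let $(\xi_i)_{i\in\mathbb Z}$ be an i.i.d. sequence with values in a measurable space $(S,\mathcal S)$, let $h\colon S^m\to\mathbb B$ be measurable, symmetric and degenerate of order $d$ with respect to $(\xi_i)_{i\in\mathbb Z}$, where $1\le d\le m$, let $n\ge 0$ be an integer and $p_n\in[0,1]$, and let $(a_{n;\mathbf i})_{\mathbf i\in\operatorname{Inc}^m_n}$ be i.i.d. Bernoulli random variables with parameter $p_n$ (value $1$ with probability $p_n$, value $0$ with probability $1-p_n$), such that the family $(a_{n;\mathbf i})_{\mathbf i\in\operatorname{Inc}^m_n}$ is independent of $(\xi_i)_{i\ge 1}$. Then the incomplete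 $U$-statistic \[U^{\mathrm{inc}}_{m,n}(h)=\sum_{\mathbf i=(i_1,\dots,i_m)\in\operatorname{Inc}^m_n}a_{n;\mathbf i}\,h(\xi_{i_1},\dots,\xi_{i_m})\] satisfies \[\mathbb E\bigl\lVert U^{\mathrm{inc}}_{m,n}(h)\bigr\rVert^q\le C\Bigl(n^{q(m-d)+dq/p}\,p_n^{q}+n^{mq/p}\,p_n^{q/p}+n^m p_n\Bigr)\,\mathbb E\lVert h(\xi_1,\dots,\xi_m)\rVert^q ,\] where both expectations are understood in $[0,\infty]$, with $0\cdot\infty=0$. -/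

import Mathlib

open MeasureTheory ProbabilityTheory

namespace IncompleteUStat

/-- The set `Inc_n^m` of the tuples `(i_1, …, i_m)` of integers such that
`1 ≤ i_1 < ⋯ < i_m ≤ n`. -/
noncomputable def Inc (m n : ℕ) : Finset (Fin m → ℤ) :=
  {i ∈ Fintype.piFinset (fun _ : Fin m => Finset.Icc (1 : ℤ) (n : ℤ)) |
    ∀ j k : Fin m, j < k → i j < i k}

/-- The random vector `(ξ_1, …, ξ_k)`. -/
def firstVec {Ω S : Type*} (ξ : ℤ → Ω → S) (k : ℕ) : Ω → (Fin k → S) :=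
  fun ω j => ξ ((j : ℤ) + 1) ω

/-- The σ-algebra generated by `(ξ_1, …, ξ_k)`; it is trivial for `k = 0`. -/
abbrev firstSigma {Ω S : Type*} [MeasurableSpace S] (ξ : ℤ → Ω → S) (k : ℕ) : MeasurableSpace Ω :=
  MeasurableSpace.comap (firstVec ξ k) inferInstance

/-- A Banach space is `r`-smooth if, for some equivalent norm `N`, the quotients
`(N (x + t y) + N (x - t y) - 2) / t ^ r` are bounded above, uniformly in `t > 0` and in
`x`, `y` with `N x = N y = 1`. -/
def IsSmoothSpace (r : ℝ) (B : Type*) [NormedAddCommGroup B] [NormedSpace ℝ B] : Prop :=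
  ∃ N : Seminorm ℝ B,
    (∃ c C : ℝ, 0 < c ∧ 0 < C ∧ ∀ x : B, c * ‖x‖ ≤ N x ∧ N x ≤ C * ‖x‖) ∧
    ∃ K : ℝ, ∀ t : ℝ, 0 < t → ∀ x y : B, N x = 1 → N y = 1 →
      (N (x + t • y) + N (x - t • y) - 2) / t ^ r ≤ K

/-- `(ξ_i)` is an i.i.d. sequence of random variables. -/
def IsIID {Ω S : Type*} [MeasurableSpace Ω] [MeasurableSpace S]
    (μ : Measure Ω) (ξ : ℤ → Ω → S) : Prop :=
  (∀ i, Measurable (ξ i)) ∧ iIndepFun ξ μ ∧ ∀ i j, IdentDistrib (ξ i) (ξ j) μ μ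

/-- The kernel `h` is a symmetric function of its `m` arguments. -/
def IsSymmKernel {S B : Type*} {m : ℕ} (h : (Fin m → S) → B) : Prop :=
  ∀ (σ : Equiv.Perm (Fin m)) (x : Fin m → S), h (fun k => x (σ k)) = h x

/-- The symmetric kernel `h` is degenerate of order `d` with respect to `(ξ_i)`: the variable
`h(ξ_1, …, ξ_m)` is integrable, its conditional expectation given `ξ_1, …, ξ_{d-1}` vanishes
almost surely, and its conditional expectation given `ξ_1, …, ξ_d` does not. -/
def IsDegenerateOfOrder {Ω S B : Type*} [MeasurableSpace Ω] [MeasurableSpace S]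
    [NormedAddCommGroup B] [NormedSpace ℝ B] [CompleteSpace B]
    (μ : Measure Ω) (ξ : ℤ → Ω → S) {m : ℕ} (h : (Fin m → S) → B) (d : ℕ) : Prop :=
  Integrable (fun ω => h (firstVec ξ m ω)) μ ∧
  μ[fun ω => h (firstVec ξ m ω) | firstSigma ξ (d - 1)] =ᵐ[μ] 0 ∧
  ∫ ω, ‖(μ[fun ω' => h (firstVec ξ m ω') | firstSigma ξ d]) ω‖ ∂μ ≠ 0

/-- The incomplete `U`-statistic `∑_{i ∈ Inc_n^m} a_i h(ξ_{i_1}, …, ξ_{i_m})`. -/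
noncomputable def incompleteUStat {Ω S B : Type*} [NormedAddCommGroup B] [NormedSpace ℝ B]
    {m n : ℕ} (a : Inc m n → Ω → ℝ) (ξ : ℤ → Ω → S) (h : (Fin m → S) → B) (ω : Ω) : B :=
  ∑ i : Inc m n, a i ω • h (fun k => ξ (i.1 k) ω)

end IncompleteUStat

/-! Writing each weight as `p_n + (a_i - p_n)` splits the statistic into `p_n` times the complete
sum over increasing tuples and a sum with centered weights, whose terms are independent once the
`ξ_i` are frozen.

Both pieces rest on one device. If `N` is the smooth norm, `N ^ q` has symmetric second differences
bounded by a multiple of `N x ^ (q - p) * N y ^ p + N y ^ q`. Convexity turns this into a one-sided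
expansion with a linear term in `y`, and that term disappears on averaging over a centered `y`: this
is `IsSmoothSpace.exists_isPotential`. Adding centered increments one at a time and absorbing the
power of the largest moment (`finset_recursion_le`) gives a Rosenthal inequality for independent
summands and a martingale analogue.

For the centered weights, Rosenthal's inequality is applied with the `ξ_i` frozen. All moments of
`a_i - p_n` of order at least one are `O(p_n)`, and there are at most `n ^ m` tuples; this produces
the terms `n ^ (m q / p) p_n ^ (q / p)` and `n ^ m p_n`.

The complete sum is treated by induction on `m`, splitting `h` into its mean over the first argument
and the remainder. The remainder yields a martingale: it costs a factor `n ^ (q / p)` and leaves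
sections of `h`, with one argument and one order of degeneracy fewer. The mean has one argument
fewer but keeps the order of degeneracy, and the triangle inequality costs `n ^ q`. Both routes end
at the exponent `q (m - d) + d q / p`. Degeneracy in the form needed for the induction comes from
the conditional expectation hypothesis through symmetry, in `IsIID.degenerateKernel`. -/

namespace IncompleteUStat

open scoped ENNReal NNReal

/-! ### Scalar inequalities and second differences of powers of a smooth norm -/

lemma tangent_le_rpow {q : ℝ} (hq : 1 < q) {a s : ℝ} (ha : 0 ≤ a) (hs : 0 ≤ s) :
    a ^ q + q * a ^ (q - 1) * (s - a) ≤ s ^ q := by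
  rcases ha.eq_or_lt with rfl | ha
  · rw [Real.zero_rpow (by linarith), Real.zero_rpow (by linarith)]
    simpa using Real.rpow_nonneg hs q
  · have h1 := one_add_mul_self_le_rpow_one_add (s := s / a - 1)
      (by have := div_nonneg hs ha.le; linarith) hq.le
    have h2 : (1 + (s / a - 1)) ^ q = s ^ q / a ^ q := by
      rw [← Real.div_rpow hs ha.le]; ring_nf
    have h3 : a ^ q = a ^ (q - 1) * a := by
      rw [← Real.rpow_add_one ha.ne']; ring_nf
    have h4 : 0 < a ^ q := Real.rpow_pos_of_pos ha q
    rw [h2, le_div_iff₀ h4] at h1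
    calc a ^ q + q * a ^ (q - 1) * (s - a) = (1 + q * (s / a - 1)) * a ^ q := by
          rw [h3]; field_simp
      _ ≤ s ^ q := h1

lemma one_add_pow_le_one_add_three_pow_mul (k : ℕ) {α : ℝ} (h0 : 0 ≤ α) (h1 : α ≤ 1) :
    (1 + α) ^ k ≤ 1 + 3 ^ k * α := by
  induction k with
  | zero => simpa using h0
  | succ k ih =>
    have h3 : (1 : ℝ) ≤ 3 ^ k := one_le_pow₀ (by norm_num)
    calc (1 + α) ^ (k + 1) = (1 + α) ^ k * (1 + α) := pow_succ _ _
      _ ≤ (1 + 3 ^ k * α) * (1 + α) := by gcongr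
      _ = 1 + (1 + 3 ^ k + 3 ^ k * α) * α := by ring
      _ ≤ 1 + (3 ^ k + 3 ^ k + 3 ^ k * 1) * α := by gcongr
      _ = 1 + 3 ^ (k + 1) * α := by ring

/-- For `q < 2` the second derivative blows up at `α = -1`, so Taylor's formula is avoided. The
tangent at `1 + α`, evaluated at `1`, leaves the error `q α ((1 + α) ^ (q - 1) - 1)`; comparing `(1
+ α) ^ (q - 1)` with the integer power `⌈q⌉₊` makes it quadratic. -/
lemma exists_one_add_rpow_le {q : ℝ} (hq : 1 < q) :
    ∃ c : ℝ, 0 ≤ c ∧ ∀ α : ℝ, -1 ≤ α → α ≤ 1 → (1 + α) ^ q ≤ 1 + q * α + c * α ^ 2 := by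
  have hM : q ≤ (⌈q⌉₊ : ℝ) := Nat.le_ceil q
  set M := ⌈q⌉₊
  refine ⟨q * (M + 3 ^ M), by positivity, fun α h1 h2 => ?_⟩
  have ht := tangent_le_rpow hq (a := 1 + α) (s := 1) (by linarith) zero_le_one
  rw [Real.one_rpow] at ht
  have key : α * ((1 + α) ^ (q - 1) - 1) ≤ (M + 3 ^ M) * α ^ 2 := by
    rcases le_total 0 α with h0 | h0
    · have : (1 + α) ^ (q - 1) ≤ (1 + α) ^ M := by
        rw [← Real.rpow_natCast]
        exact Real.rpow_le_rpow_of_exponent_le (by linarith) (by linarith)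
      have h3 := one_add_pow_le_one_add_three_pow_mul M h0 h2
      calc α * ((1 + α) ^ (q - 1) - 1) ≤ α * (3 ^ M * α) := by
            apply mul_le_mul_of_nonneg_left _ h0; linarith
        _ = (0 + 3 ^ M) * α ^ 2 := by ring
        _ ≤ _ := by gcongr; positivity
    · have : (1 + α) ^ M ≤ (1 + α) ^ (q - 1) := by
        rw [← Real.rpow_natCast]
        exact Real.rpow_le_rpow_of_exponent_ge_of_imp (by linarith) (by linarith) (by linarith)
          (by intro _ h; exfalso; linarith)
      have h3 := one_add_mul_le_pow (a := α) (by linarith) M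
      calc α * ((1 + α) ^ (q - 1) - 1) ≤ α * (M * α) := by
            apply mul_le_mul_of_nonpos_left _ h0; linarith
        _ = (M + 0) * α ^ 2 := by ring
        _ ≤ _ := by gcongr; positivity
  nlinarith [mul_le_mul_of_nonneg_left key (by linarith : (0 : ℝ) ≤ q)]

/-- To be used with `a = N (x + y)`, `b = N (x - y)`, `X = N x`, `Y = N y`. The first-order terms in
`a / X - 1` and `b / X - 1` are controlled only through their sum, which is where smoothness enters;
the quadratic ones are at most `(Y / X) ^ p` because `p ≤ 2` and `Y ≤ X`. -/
lemma exists_rpow_add_rpow_le {p q : ℝ} (hp : 1 < p) (hp2 : p ≤ 2) (hpq : p ≤ q) {K : ℝ}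
    (hK : 0 ≤ K) :
    ∃ C : ℝ, 0 ≤ C ∧ ∀ a b X Y : ℝ, 0 ≤ a → 0 ≤ b → 0 < X → 0 ≤ Y → Y ≤ X →
      |a - X| ≤ Y → |b - X| ≤ Y → a + b ≤ 2 * X + K * X * (Y / X) ^ p →
      a ^ q + b ^ q ≤ 2 * X ^ q + C * (X ^ (q - p) * Y ^ p) := by
  have hq : 1 < q := by linarith
  obtain ⟨c, hc, H⟩ := exists_one_add_rpow_le hq
  refine ⟨q * K + 2 * c, by positivity, fun a b X Y ha hb hX hY hYX haX hbX hab => ?_⟩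
  have ht0 : 0 ≤ Y / X := by positivity
  have ht1 : Y / X ≤ 1 := (div_le_one hX).2 hYX
  have hsq : (Y / X) ^ 2 ≤ (Y / X) ^ p := by
    rw [← Real.rpow_two]
    exact Real.rpow_le_rpow_of_exponent_ge_of_imp ht0 ht1 hp2 (by intro _ h; exfalso; linarith)
  have main : ∀ a : ℝ, 0 ≤ a → |a - X| ≤ Y →
      a ^ q ≤ X ^ q * (1 + q * (a / X - 1) + c * (Y / X) ^ p) := by
    intro a ha haX
    have h1 : |a / X - 1| ≤ Y / X := by
      rw [show a / X - 1 = (a - X) / X by field_simp, abs_div, abs_of_pos hX]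
      gcongr
    have h2 := H (a / X - 1) (by linarith [(abs_le.1 h1).1]) (by linarith [(abs_le.1 h1).2])
    have h3 : a ^ q = X ^ q * (1 + (a / X - 1)) ^ q := by
      rw [← Real.mul_rpow hX.le (by have := div_nonneg ha hX.le; linarith)]
      congr 1; field_simp; ring
    rw [h3]
    have h4 : (a / X - 1) ^ 2 ≤ (Y / X) ^ p := by
      refine le_trans ?_ hsq
      rw [← sq_abs]; gcongr
    gcongr
    exact h2.trans (by gcongr)
  have hXY : X ^ q * (Y / X) ^ p = X ^ (q - p) * Y ^ p := by
    rw [Real.div_rpow hY hX.le, Real.rpow_sub hX]; field_simp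
  have hsum : (a / X - 1) + (b / X - 1) ≤ K * (Y / X) ^ p := by
    have : a / X + b / X ≤ 2 + K * (Y / X) ^ p := by
      rw [← add_div, div_le_iff₀ hX]; linarith
    linarith
  calc a ^ q + b ^ q ≤ _ := add_le_add (main a ha haX) (main b hb hbX)
    _ = X ^ q * (2 + q * ((a / X - 1) + (b / X - 1)) + 2 * c * (Y / X) ^ p) := by ring
    _ ≤ X ^ q * (2 + q * (K * (Y / X) ^ p) + 2 * c * (Y / X) ^ p) := by gcongr
    _ = 2 * X ^ q + (q * K + 2 * c) * (X ^ q * (Y / X) ^ p) := by ring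
    _ = _ := by rw [hXY]

variable {B : Type*} [NormedAddCommGroup B] [NormedSpace ℝ B]

/-- A seminorm satisfying the `r`-smoothness condition has `q`-th powers with controlled
symmetric second differences, for all `p ≤ r` and `q ≥ p`. -/
lemma exists_seminorm_rpow_add_rpow_le {p q r : ℝ} (hp : 1 < p) (hpr : p ≤ r) (hr : r ≤ 2)
    (hpq : p ≤ q) {N : Seminorm ℝ B} (hN : ∀ x, N x = 0 → x = 0) {K : ℝ}
    (hK : ∀ t : ℝ, 0 < t → ∀ x y : B, N x = 1 → N y = 1 →
      (N (x + t • y) + N (x - t • y) - 2) / t ^ r ≤ K) :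
    ∃ C : ℝ, 0 ≤ C ∧ ∀ x y : B, N (x + y) ^ q + N (x - y) ^ q ≤
      2 * N x ^ q + C * (N x ^ (q - p) * N y ^ p + N y ^ q) := by
  have hq : 1 < q := by linarith
  obtain ⟨C, hC, H⟩ := exists_rpow_add_rpow_le hp (hpr.trans hr) hpq (le_max_right K 0)
  refine ⟨C + 2 * 2 ^ q, by positivity, fun x y => ?_⟩
  have n0 : ∀ z, 0 ≤ N z := fun z => apply_nonneg N z
  have e1 : 0 ≤ N x ^ (q - p) * N y ^ p :=
    mul_nonneg (Real.rpow_nonneg (n0 _) _) (Real.rpow_nonneg (n0 _) _)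
  have e2 : 0 ≤ N y ^ q := Real.rpow_nonneg (n0 _) _
  have e3 : 0 ≤ N x ^ q := Real.rpow_nonneg (n0 _) _
  have e4 : (0 : ℝ) ≤ 2 ^ q := by positivity
  have a1 : N (x + y) ≤ N x + N y := map_add_le_add N x y
  have a2 : N (x - y) ≤ N x + N y := map_sub_le_add N x y
  rcases le_total (N y) (N x) with hyx | hxy
  · rcases (n0 x).eq_or_lt with hx | hx
    · have hx0 : x = 0 := hN x hx.symm
      have hy0 : y = 0 := hN y (le_antisymm (hyx.trans hx.symm.le) (n0 y))
      subst hx0 hy0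
      simp only [add_zero, sub_zero, map_zero]
      rw [Real.zero_rpow (x := p) (by linarith), Real.zero_rpow (x := q) (by linarith)]
      simp
    rcases (n0 y).eq_or_lt with hy | hy
    · have hy0 : y = 0 := hN y hy.symm
      subst hy0
      simp only [add_zero, sub_zero, map_zero]
      rw [Real.zero_rpow (x := p) (by linarith), Real.zero_rpow (x := q) (by linarith)]
      simp only [mul_zero, add_zero]; linarith
    have b1 : |N (x + y) - N x| ≤ N y := by
      have h := abs_sub_map_le_sub N (x + y) x
      rwa [add_sub_cancel_left] at h
    have b2 : |N (x - y) - N x| ≤ N y := by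
      have h := abs_sub_map_le_sub N (x - y) x
      rwa [sub_sub_cancel_left, map_neg_eq_map] at h
    -- Smoothness is applied to the normalized vectors with `t = N y / N x ≤ 1`, so that `t ^ r ≤ t
    -- ^ p`; `max K 0` guards against a negative `K`.
    have b3 : N (x + y) + N (x - y) ≤ 2 * N x + max K 0 * N x * (N y / N x) ^ p := by
      have ht : 0 < N y / N x := by positivity
      have hu : ∀ z, 0 < N z → N ((N z)⁻¹ • z) = 1 := by
        intro z hz
        rw [map_smul_eq_mul, Real.norm_eq_abs, abs_of_pos (by positivity),
          inv_mul_cancel₀ hz.ne']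
      have h := hK _ ht _ _ (hu x hx) (hu y hy)
      have s1 : (N x)⁻¹ • x + (N y / N x) • (N y)⁻¹ • y = (N x)⁻¹ • (x + y) := by
        rw [smul_smul, smul_add]; congr 2; field_simp
      have s2 : (N x)⁻¹ • x - (N y / N x) • (N y)⁻¹ • y = (N x)⁻¹ • (x - y) := by
        rw [smul_smul, smul_sub]; congr 2; field_simp
      rw [s1, s2, map_smul_eq_mul, map_smul_eq_mul, Real.norm_eq_abs,
        abs_of_pos (by positivity : 0 < (N x)⁻¹),
        div_le_iff₀ (Real.rpow_pos_of_pos ht r)] at h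
      have h1 : (N y / N x) ^ r ≤ (N y / N x) ^ p :=
        Real.rpow_le_rpow_of_exponent_ge ht ((div_le_one hx).2 hyx) hpr
      have h2 : K * (N y / N x) ^ r ≤ max K 0 * (N y / N x) ^ p :=
        mul_le_mul (le_max_left _ _) h1 (by positivity) (le_max_right _ _)
      have h3 : (N x)⁻¹ * N (x + y) + (N x)⁻¹ * N (x - y) ≤ 2 + max K 0 * (N y / N x) ^ p := by
        linarith
      rw [← mul_add, inv_mul_le_iff₀ hx] at h3
      calc _ ≤ _ := h3
        _ = _ := by ring
    have := H _ _ _ _ (n0 _) (n0 _) hx (n0 y) hyx b1 b2 b3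
    nlinarith [mul_nonneg e4 e1, mul_nonneg e4 e2, mul_nonneg hC e2]
  -- When `N y` dominates, the triangle inequality suffices and produces the term `N y ^ q`.
  · have b1 : N (x + y) ^ q ≤ 2 ^ q * N y ^ q := by
      rw [← Real.mul_rpow (by norm_num) (n0 y)]
      exact Real.rpow_le_rpow (n0 _) (by linarith) (by linarith)
    have b2 : N (x - y) ^ q ≤ 2 ^ q * N y ^ q := by
      rw [← Real.mul_rpow (by norm_num) (n0 y)]
      exact Real.rpow_le_rpow (n0 _) (by linarith) (by linarith)
    nlinarith [mul_nonneg e4 e1, mul_nonneg hC e1, mul_nonneg hC e2]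

/-- A seminorm has a supporting linear functional at each point. -/
lemma exists_linearMap_le_seminorm (N : Seminorm ℝ B) (x : B) :
    ∃ f : B →ₗ[ℝ] ℝ, f x = N x ∧ ∀ y, f y ≤ N y := by
  by_cases hx : x = 0
  · exact ⟨0, by simp [hx], fun y => by simp⟩
  have := exists_extension_of_le_sublinear (LinearPMap.mkSpanSingleton (K := ℝ) x (N x) hx) N
    (fun c hc y => by rw [map_smul_eq_mul, Real.norm_eq_abs, abs_of_pos hc])
    (fun y z => map_add_le_add N y z) ?_
  · obtain ⟨g, hg, hN⟩ := this
    refine ⟨g, ?_, hN⟩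
    have h1 := hg ⟨x, Submodule.mem_span_singleton_self x⟩
    rw [h1]
    exact LinearPMap.mkSpanSingleton_apply ℝ ℝ hx (N x)
  · rintro ⟨z, hz⟩
    obtain ⟨c, rfl⟩ := Submodule.mem_span_singleton.1 hz
    have h1 : LinearPMap.mkSpanSingleton (K := ℝ) x (N x) hx ⟨c • x, hz⟩ = c • N x :=
      LinearPMap.mkSpanSingleton'_apply _ _ _ _ _
    rw [h1, map_smul_eq_mul]
    exact mul_le_mul_of_nonneg_right (le_abs_self c) (apply_nonneg N x)

end IncompleteUStat

/-! ### Moment recursion and construction of the potential -/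

namespace IncompleteUStat

open scoped ENNReal NNReal

/-- Absorption: the larger of the two terms on the right is at least half of `U`. If it is the
first, dividing by `U ^ (1 - 1 / s)`, which needs `U` finite, leaves a bound on `U ^ (1 / s)`. -/
lemma le_of_le_mul_rpow_add {s : ℝ} (hs : 1 ≤ s) {U V W : ℝ≥0∞} (hU : U ≠ ∞)
    (h : U ≤ U ^ (1 - 1 / s) * V + W) : U ≤ (2 * V) ^ s + 2 * W := by
  have hs0 : 0 < s := by linarith
  rcases le_total (U ^ (1 - 1 / s) * V) W with hW | hW
  · calc U ≤ W + W := h.trans (by gcongr)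
      _ = 2 * W := (two_mul W).symm
      _ ≤ _ := le_add_self
  · have h1 : U ≤ U ^ (1 - 1 / s) * (2 * V) := by
      calc U ≤ U ^ (1 - 1 / s) * V + U ^ (1 - 1 / s) * V := h.trans (by gcongr)
        _ = _ := by ring
    rcases eq_or_ne U 0 with rfl | hU0
    · simp
    have h2 : U ^ (1 - 1 / s) * U ^ (1 / s) ≤ U ^ (1 - 1 / s) * (2 * V) := by
      rw [← ENNReal.rpow_add _ _ hU0 hU]
      simpa using h1
    have h3 : U ^ (1 / s) ≤ 2 * V := by
      refine (ENNReal.mul_le_mul_iff_right ?_ ?_).1 h2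
      · exact (ENNReal.rpow_pos (pos_iff_ne_zero.2 hU0) hU).ne'
      · exact ENNReal.rpow_ne_top_of_ne_zero hU0 hU
    calc U = (U ^ (1 / s)) ^ s := by
          rw [← ENNReal.rpow_mul, one_div_mul_cancel hs0.ne', ENNReal.rpow_one]
      _ ≤ (2 * V) ^ s := by gcongr
      _ ≤ _ := le_self_add

/-- Since `u` need not be monotone, each `u t` is replaced in the recursion by the maximum `U` over
all subsets of `I`. Summing the steps then bounds `U` by its own power `1 - 1 / s`, which is
absorbed. In the applications `s = q / p`, so a sum of `p`-th moments is raised to `q / p` while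
`q`-th moments enter linearly. -/
lemma finset_recursion_le {ι : Type*} [DecidableEq ι] {s : ℝ} (hs : 1 ≤ s) (I : Finset ι)
    (u : Finset ι → ℝ≥0∞) (v w : ι → ℝ≥0∞) {C : ℝ≥0∞} (hC1 : 1 ≤ C) (hC : C ≠ ∞) (h0 : u ∅ = 0)
    (hstep : ∀ i t, i ∉ t → insert i t ⊆ I →
      u (insert i t) ≤ u t + C * (u t ^ (1 - 1 / s) * v i + w i)) :
    u I ≤ (2 * C * ∑ i ∈ I, v i) ^ s + 2 * C * ∑ i ∈ I, w i := by
  have hs0 : 0 < s := by linarith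
  have hC0 : C ≠ 0 := (zero_lt_one.trans_le hC1).ne'
  have hexp : 0 ≤ 1 - 1 / s := by
    rw [sub_nonneg, div_le_one hs0]; exact hs
  by_cases hV : ∑ i ∈ I, v i = ∞
  · rw [hV, ENNReal.mul_top (by simp [hC0]), ENNReal.top_rpow_of_pos hs0]; simp
  by_cases hW : ∑ i ∈ I, w i = ∞
  · rw [hW, ENNReal.mul_top (by simp [hC0])]; simp
  have hfin : ∀ t, t ⊆ I → u t ≠ ∞ := by
    intro t
    induction t using Finset.induction_on with
    | empty => intro _; simp [h0]
    | insert i t hi ih =>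
      intro hti
      have hiI : i ∈ I := hti (Finset.mem_insert_self i t)
      have hut := ih ((Finset.subset_insert i t).trans hti)
      have hv : v i ≠ ∞ := fun h => hV (ENNReal.sum_eq_top.2 ⟨i, hiI, h⟩)
      have hw : w i ≠ ∞ := fun h => hW (ENNReal.sum_eq_top.2 ⟨i, hiI, h⟩)
      refine ne_top_of_le_ne_top ?_ (hstep i t hi hti)
      exact ENNReal.add_ne_top.2 ⟨hut, ENNReal.mul_ne_top hC (ENNReal.add_ne_top.2
        ⟨ENNReal.mul_ne_top (ENNReal.rpow_ne_top_of_nonneg hexp hut) hv, hw⟩)⟩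
  set U := I.powerset.sup u with hUdef
  have hU : U ≠ ∞ := by
    rw [← lt_top_iff_ne_top, hUdef, Finset.sup_lt_iff (by simp)]
    intro t ht
    exact lt_top_iff_ne_top.2 (hfin t (Finset.mem_powerset.1 ht))
  have hle : ∀ t, t ⊆ I → u t ≤ U := fun t ht => Finset.le_sup (Finset.mem_powerset.2 ht)
  have hind : ∀ t, t ⊆ I → u t ≤ C * (U ^ (1 - 1 / s) * (∑ i ∈ t, v i) + ∑ i ∈ t, w i) := by
    intro t
    induction t using Finset.induction_on with
    | empty => intro _; simp [h0]
    | insert i t hi ih =>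
      intro hti
      have hsub := (Finset.subset_insert i t).trans hti
      rw [Finset.sum_insert hi, Finset.sum_insert hi]
      calc _ ≤ _ := hstep i t hi hti
        _ ≤ C * (U ^ (1 - 1 / s) * (∑ i ∈ t, v i) + ∑ i ∈ t, w i)
            + C * (U ^ (1 - 1 / s) * v i + w i) := by
          have := hle t hsub
          gcongr
          exact ih hsub
        _ = _ := by ring
  have hUle : U ≤ U ^ (1 - 1 / s) * (C * ∑ i ∈ I, v i) + C * ∑ i ∈ I, w i := by
    refine Finset.sup_le fun t ht => ?_
    have ht := Finset.mem_powerset.1 ht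
    calc _ ≤ _ := hind t ht
      _ ≤ C * (U ^ (1 - 1 / s) * (∑ i ∈ I, v i) + ∑ i ∈ I, w i) := by gcongr
      _ = _ := by ring
  calc u I ≤ U := hle I subset_rfl
    _ ≤ _ := le_of_le_mul_rpow_add hs hU hUle
    _ = _ := by rw [mul_assoc, mul_assoc]

variable {B : Type*} [NormedAddCommGroup B] [NormedSpace ℝ B]

/-- The symmetric bound becomes one-sided by moving `N (x - y) ^ q` to the right and bounding it
below by convexity. The linear term is `q N x ^ (q - 1)` times a supporting functional of `N` at
`x`, so no differentiability is required. -/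
lemma seminorm_add_rpow_le {p q : ℝ} (hp : 1 < p) (hpq : p ≤ q) {N : Seminorm ℝ B} {C₁ C : ℝ}
    (hC₁ : 1 ≤ C₁) (hC : 0 ≤ C) (hN : ∀ x, N x ≤ C₁ * ‖x‖)
    (H : ∀ x y : B, N (x + y) ^ q + N (x - y) ^ q ≤
      2 * N x ^ q + C * (N x ^ (q - p) * N y ^ p + N y ^ q)) (x : B) :
    ∃ f : B →L[ℝ] ℝ, ∀ y, N (x + y) ^ q ≤
      N x ^ q + f y + C * C₁ ^ q * (‖x‖ ^ (q - p) * ‖y‖ ^ p + ‖y‖ ^ q) := by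
  obtain ⟨f, hfx, hf⟩ := exists_linearMap_le_seminorm N x
  have n0 : ∀ z, 0 ≤ N z := fun z => apply_nonneg N z
  have hC0 : 0 < C₁ := by linarith
  have hfb : ∀ y, ‖f y‖ ≤ C₁ * ‖y‖ := by
    intro y
    rw [Real.norm_eq_abs, abs_le]
    have h1 := hf (-y)
    rw [map_neg, map_neg_eq_map] at h1
    exact ⟨by linarith [hN y], by linarith [hN y, hf y]⟩
  refine ⟨(q * N x ^ (q - 1)) • f.mkContinuous C₁ hfb, fun y => ?_⟩
  have h1 := tangent_le_rpow (q := q) (by linarith) (n0 x) (n0 (x - y))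
  have h2 : -(f y) ≤ N (x - y) - N x := by
    have := hf (x - y)
    rw [map_sub] at this
    linarith
  have h3 : q * N x ^ (q - 1) * (-(f y)) ≤ q * N x ^ (q - 1) * (N (x - y) - N x) := by
    have := Real.rpow_nonneg (n0 x) (q - 1)
    have hq : 0 ≤ q := by linarith
    gcongr
  have h4 : N x ^ (q - p) * N y ^ p + N y ^ q ≤
      C₁ ^ q * (‖x‖ ^ (q - p) * ‖y‖ ^ p + ‖y‖ ^ q) := by
    have e1 : N x ^ (q - p) ≤ C₁ ^ (q - p) * ‖x‖ ^ (q - p) := by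
      rw [← Real.mul_rpow hC0.le (norm_nonneg x)]
      exact Real.rpow_le_rpow (n0 x) (hN x) (by linarith)
    have e2 : N y ^ p ≤ C₁ ^ p * ‖y‖ ^ p := by
      rw [← Real.mul_rpow hC0.le (norm_nonneg y)]
      exact Real.rpow_le_rpow (n0 y) (hN y) (by linarith)
    have e3 : N y ^ q ≤ C₁ ^ q * ‖y‖ ^ q := by
      rw [← Real.mul_rpow hC0.le (norm_nonneg y)]
      exact Real.rpow_le_rpow (n0 y) (hN y) (by linarith)
    have e4 : C₁ ^ q = C₁ ^ (q - p) * C₁ ^ p := by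
      rw [← Real.rpow_add hC0]; ring_nf
    calc _ ≤ (C₁ ^ (q - p) * ‖x‖ ^ (q - p)) * (C₁ ^ p * ‖y‖ ^ p) + C₁ ^ q * ‖y‖ ^ q := by
          have := Real.rpow_nonneg (n0 y) p
          gcongr
      _ = _ := by rw [e4]; ring
  have h5 := mul_le_mul_of_nonneg_left h4 hC
  have h6 := H x y
  simp only [smul_apply, LinearMap.mkContinuous_apply, smul_eq_mul]
  linarith

variable [MeasurableSpace B]

/-- A function `Φ` comparable to `‖·‖ ^ q` such that adding a centered random vector to a fixed
vector increases the mean of `Φ` in a controlled way. -/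
structure IsPotential (p q : ℝ) (Φ : B → ℝ≥0∞) (c : ℝ≥0∞) : Prop where
  measurable : Measurable Φ
  one_le : 1 ≤ c
  ne_top : c ≠ ∞
  enorm_rpow_le : ∀ x, ‖x‖ₑ ^ q ≤ c * Φ x
  le_enorm_rpow : ∀ x, Φ x ≤ c * ‖x‖ₑ ^ q
  lintegral_add_le : ∀ (ρ : Measure B) [IsProbabilityMeasure ρ], Integrable id ρ →
    ∫ y, y ∂ρ = 0 → ∀ x, ∫⁻ y, Φ (x + y) ∂ρ ≤
      Φ x + c * (‖x‖ₑ ^ (q - p) * ∫⁻ y, ‖y‖ₑ ^ p ∂ρ + ∫⁻ y, ‖y‖ₑ ^ q ∂ρ)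

variable [CompleteSpace B] [BorelSpace B]

lemma lintegral_seminorm_add_rpow_le {p q : ℝ} (hp : 1 < p) (hpq : p ≤ q) {N : B → ℝ}
    (hN0 : ∀ x, 0 ≤ N x) {D : ℝ} (hD : 0 < D) (x : B)
    (H : ∃ f : B →L[ℝ] ℝ, ∀ y, N (x + y) ^ q ≤
      N x ^ q + f y + D * (‖x‖ ^ (q - p) * ‖y‖ ^ p + ‖y‖ ^ q))
    (ρ : Measure B) [IsProbabilityMeasure ρ] (hint : Integrable id ρ) (hmean : ∫ y, y ∂ρ = 0) :
    ∫⁻ y, ENNReal.ofReal (N (x + y) ^ q) ∂ρ ≤ ENNReal.ofReal (N x ^ q) +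
      ENNReal.ofReal D * (‖x‖ₑ ^ (q - p) * ∫⁻ y, ‖y‖ₑ ^ p ∂ρ + ∫⁻ y, ‖y‖ₑ ^ q ∂ρ) := by
  obtain ⟨f, hf⟩ := H
  have hq0 : 0 < q := by linarith
  have hp0 : 0 < p := by linarith
  -- With an infinite `q`-th moment the right side is infinite because `D > 0`; otherwise every term
  -- of the pointwise bound is integrable and the mean of `f` vanishes.
  by_cases htop : ∫⁻ y, ‖y‖ₑ ^ q ∂ρ = ∞
  · rw [htop, add_top, ENNReal.mul_top (by simpa using hD)]; simp
  have en : ∀ (y : B) (t : ℝ), 0 ≤ t → ‖y‖ₑ ^ t = ENNReal.ofReal (‖y‖ ^ t) := by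
    intro y t ht
    rw [← ofReal_norm, ENNReal.ofReal_rpow_of_nonneg (norm_nonneg y) ht]
  have intq : Integrable (fun y : B => ‖y‖ ^ q) ρ := by
    refine ⟨(measurable_norm.pow_const q).aestronglyMeasurable, ?_⟩
    rw [hasFiniteIntegral_iff_ofReal (ae_of_all _ fun y => by positivity), lt_top_iff_ne_top]
    simpa only [en _ q hq0.le] using htop
  have intp : Integrable (fun y : B => ‖y‖ ^ p) ρ := by
    refine (intq.add (integrable_const (1 : ℝ))).mono'
      (measurable_norm.pow_const p).aestronglyMeasurable (ae_of_all _ fun y => ?_)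
    rw [Real.norm_of_nonneg (by positivity)]
    rcases le_total ‖y‖ 1 with h | h
    · have : ‖y‖ ^ p ≤ 1 := Real.rpow_le_one (norm_nonneg y) h hp0.le
      have := Real.rpow_nonneg (norm_nonneg y) q
      simp only [Pi.add_apply]; linarith
    · have : ‖y‖ ^ p ≤ ‖y‖ ^ q := Real.rpow_le_rpow_of_exponent_le h hpq
      simp only [Pi.add_apply]; linarith
  have intf : Integrable (fun y => f y) ρ := f.integrable_comp hint
  have meanf : ∫ y, f y ∂ρ = 0 := by
    have := f.integral_comp_comm hint
    simp only [id] at this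
    rw [this, hmean, map_zero]
  have int1 : Integrable (fun y => N x ^ q + f y) ρ := (integrable_const _).add intf
  have int2 : Integrable (fun y => ‖x‖ ^ (q - p) * ‖y‖ ^ p + ‖y‖ ^ q) ρ :=
    (intp.const_mul _).add intq
  have int3 : Integrable (fun y => N x ^ q + f y +
      D * (‖x‖ ^ (q - p) * ‖y‖ ^ p + ‖y‖ ^ q)) ρ := int1.add (int2.const_mul D)
  have hnn : ∀ y, 0 ≤ N x ^ q + f y + D * (‖x‖ ^ (q - p) * ‖y‖ ^ p + ‖y‖ ^ q) :=
    fun y => (Real.rpow_nonneg (hN0 _) q).trans (hf y)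
  have hval : ∫ y, (N x ^ q + f y + D * (‖x‖ ^ (q - p) * ‖y‖ ^ p + ‖y‖ ^ q)) ∂ρ =
      N x ^ q + D * (‖x‖ ^ (q - p) * ∫ y, ‖y‖ ^ p ∂ρ + ∫ y, ‖y‖ ^ q ∂ρ) := by
    rw [integral_add int1 (int2.const_mul D), integral_add (integrable_const _) intf, meanf,
      integral_const_mul, integral_add (intp.const_mul _) intq, integral_const_mul]
    simp
  calc ∫⁻ y, ENNReal.ofReal (N (x + y) ^ q) ∂ρ
      ≤ ∫⁻ y, ENNReal.ofReal (N x ^ q + f y +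
          D * (‖x‖ ^ (q - p) * ‖y‖ ^ p + ‖y‖ ^ q)) ∂ρ :=
        lintegral_mono fun y => ENNReal.ofReal_le_ofReal (hf y)
    _ = ENNReal.ofReal (N x ^ q +
          D * (‖x‖ ^ (q - p) * ∫ y, ‖y‖ ^ p ∂ρ + ∫ y, ‖y‖ ^ q ∂ρ)) := by
        rw [← ofReal_integral_eq_lintegral_ofReal int3 (ae_of_all _ hnn), hval]
    _ = _ := by
        have i1 : 0 ≤ ∫ y, ‖y‖ ^ p ∂ρ := integral_nonneg fun y => by positivity
        have i2 : 0 ≤ ∫ y, ‖y‖ ^ q ∂ρ := integral_nonneg fun y => by positivity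
        rw [ENNReal.ofReal_add (Real.rpow_nonneg (hN0 x) q) (by positivity),
          ENNReal.ofReal_mul hD.le, ENNReal.ofReal_add (by positivity) i2,
          ENNReal.ofReal_mul (by positivity), ← en x (q - p) (by linarith),
          ofReal_integral_eq_lintegral_ofReal intp (ae_of_all _ fun y => by positivity),
          ofReal_integral_eq_lintegral_ofReal intq (ae_of_all _ fun y => by positivity)]
        simp only [en _ p hp0.le, en _ q hq0.le]

lemma IsSmoothSpace.exists_isPotential {p q r : ℝ} (hp : 1 < p) (hpr : p ≤ r) (hr : r ≤ 2)
    (hpq : p ≤ q) (hB : IsSmoothSpace r B) :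
    ∃ (Φ : B → ℝ≥0∞) (c : ℝ≥0∞), IsPotential p q Φ c := by
  obtain ⟨N, ⟨c₀, C₀, hc₀, hC₀, hN⟩, K, hK⟩ := hB
  have hq0 : 0 < q := by linarith
  have n0 : ∀ z, 0 ≤ N z := fun z => apply_nonneg N z
  have hNz : ∀ x, N x = 0 → x = 0 := fun x hx => by
    have h := (hN x).1
    rw [hx] at h
    exact norm_le_zero_iff.1 (by nlinarith [norm_nonneg x])
  obtain ⟨C, hC, H⟩ := exists_seminorm_rpow_add_rpow_le hp hpr hr hpq hNz hK
  set C₁ := max C₀ 1 with hC₁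
  have hC₁1 : 1 ≤ C₁ := le_max_right _ _
  have hN1 : ∀ x, N x ≤ C₁ * ‖x‖ := fun x => (hN x).2.trans (by
    gcongr; exact le_max_left _ _)
  have hNc : Continuous N := Seminorm.continuous_of_le (q := C₁.toNNReal • normSeminorm ℝ B)
    (by
      have : Continuous fun x : B => C₁ * ‖x‖ := by fun_prop
      convert this using 2 with x
      simp [NNReal.smul_def, Real.coe_toNNReal C₁ (by linarith)]) (by
      intro x
      simpa [NNReal.smul_def, Real.coe_toNNReal C₁ (by linarith)] using hN1 x)
  -- The summand `1` makes `D` positive and ensures `1 ≤ c` below.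
  set D := C * C₁ ^ q + 1 with hD
  have hD0 : 0 < D := by positivity
  set c : ℝ := max D (max (C₁ ^ q) (c₀⁻¹ ^ q)) with hc
  have en : ∀ y : B, ‖y‖ₑ ^ q = ENNReal.ofReal (‖y‖ ^ q) := by
    intro y
    rw [← ofReal_norm, ENNReal.ofReal_rpow_of_nonneg (norm_nonneg y) hq0.le]
  have hc0 : 0 ≤ c := hD0.le.trans (le_max_left _ _)
  refine ⟨fun x => ENNReal.ofReal (N x ^ q), ENNReal.ofReal c, ?_, ?_, ENNReal.ofReal_ne_top,
    fun x => ?_, fun x => ?_, fun ρ _ hint hmean x => ?_⟩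
  · exact (hNc.measurable.pow_const q).ennreal_ofReal
  · rw [← ENNReal.ofReal_one]
    refine ENNReal.ofReal_le_ofReal (le_trans ?_ (le_max_left _ _))
    have : 0 ≤ C * C₁ ^ q := by positivity
    linarith
  · rw [en, ← ENNReal.ofReal_mul hc0]
    refine ENNReal.ofReal_le_ofReal ?_
    calc ‖x‖ ^ q ≤ (c₀⁻¹ * N x) ^ q := by
          refine Real.rpow_le_rpow (norm_nonneg x) ?_ hq0.le
          rw [le_inv_mul_iff₀ hc₀]; exact (hN x).1
      _ = c₀⁻¹ ^ q * N x ^ q := Real.mul_rpow (by positivity) (n0 x)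
      _ ≤ c * N x ^ q := by
        refine mul_le_mul_of_nonneg_right ?_ (Real.rpow_nonneg (n0 x) q)
        exact (le_max_right _ _).trans (le_max_right _ _)
  · rw [en, ← ENNReal.ofReal_mul hc0]
    refine ENNReal.ofReal_le_ofReal ?_
    calc N x ^ q ≤ (C₁ * ‖x‖) ^ q := Real.rpow_le_rpow (n0 x) (hN1 x) hq0.le
      _ = C₁ ^ q * ‖x‖ ^ q := Real.mul_rpow (by positivity) (norm_nonneg x)
      _ ≤ c * ‖x‖ ^ q := by
        gcongr
        exact (le_max_left _ _).trans (le_max_right _ _)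
  · refine (lintegral_seminorm_add_rpow_le hp hpq n0 hD0 x ?_ ρ hint hmean).trans ?_
    · obtain ⟨f, hf⟩ := seminorm_add_rpow_le hp hpq hC₁1 hC hN1 H x
      refine ⟨f, fun y => (hf y).trans ?_⟩
      gcongr
      linarith
    · gcongr
      exact le_max_left _ _

end IncompleteUStat

/-! ### Martingale step and Rosenthal's inequality -/

namespace IncompleteUStat

open scoped ENNReal NNReal

section Inequalities

variable {α : Type*} [MeasurableSpace α] {μ : Measure α}

lemma lintegral_rpow_le_rpow_lintegral [IsProbabilityMeasure μ] {f : α → ℝ≥0∞}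
    (hf : AEMeasurable f μ) {t : ℝ} (h0 : 0 ≤ t) (h1 : t ≤ 1) :
    ∫⁻ x, f x ^ t ∂μ ≤ (∫⁻ x, f x ∂μ) ^ t := by
  have := ENNReal.lintegral_mul_norm_pow_le (μ := μ) hf (aemeasurable_const (b := (1 : ℝ≥0∞))) h0
    (sub_nonneg.2 h1) (by ring)
  simpa using this

lemma rpow_lintegral_le_lintegral_rpow [IsProbabilityMeasure μ] {f : α → ℝ≥0∞}
    (hf : AEMeasurable f μ) {q : ℝ} (hq : 1 ≤ q) :
    (∫⁻ x, f x ∂μ) ^ q ≤ ∫⁻ x, f x ^ q ∂μ := by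
  have hq0 : 0 < q := by linarith
  have h := lintegral_rpow_le_rpow_lintegral (hf.pow_const q) (t := q⁻¹) (by positivity)
    (inv_le_one_of_one_le₀ hq)
  simp only [ENNReal.rpow_rpow_inv hq0.ne'] at h
  calc _ ≤ ((∫⁻ x, f x ^ q ∂μ) ^ q⁻¹) ^ q := by gcongr
    _ = _ := ENNReal.rpow_inv_rpow hq0.ne' _

lemma enorm_add_rpow_le {E : Type*} [NormedAddCommGroup E] {q : ℝ} (hq : 1 ≤ q) (x y : E) :
    ‖x + y‖ₑ ^ q ≤ 2 ^ (q - 1) * (‖x‖ₑ ^ q + ‖y‖ₑ ^ q) :=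
  (ENNReal.rpow_le_rpow (enorm_add_le x y) (by linarith)).trans
    (ENNReal.rpow_add_le_mul_rpow_add_rpow _ _ hq)

lemma enorm_sub_rpow_le {E : Type*} [NormedAddCommGroup E] {q : ℝ} (hq : 1 ≤ q) (x y : E) :
    ‖x - y‖ₑ ^ q ≤ 2 ^ (q - 1) * (‖x‖ₑ ^ q + ‖y‖ₑ ^ q) := by
  rw [sub_eq_add_neg, ← enorm_neg y]
  exact enorm_add_rpow_le hq x (-y)

end Inequalities

variable {B : Type*} [NormedAddCommGroup B] [NormedSpace ℝ B] [MeasurableSpace B]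
variable {p q : ℝ} {Φ : B → ℝ≥0∞} {c : ℝ≥0∞}

lemma IsPotential.map_zero (hΦ : IsPotential p q Φ c) (hq : 0 < q) : Φ 0 = 0 := by
  have := hΦ.le_enorm_rpow 0
  simpa [ENNReal.zero_rpow_of_pos hq] using this

variable [BorelSpace B] [SecondCountableTopology B]

lemma IsPotential.lintegral_comp_add_le (hΦ : IsPotential p q Φ c) {T : Type*} [MeasurableSpace T]
    {ν : Measure T} [IsProbabilityMeasure ν] {Y : T → B} (hY : Integrable Y ν)
    (hmean : ∫ t, Y t ∂ν = 0) (x : B) :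
    ∫⁻ t, Φ (x + Y t) ∂ν ≤
      Φ x + c * (‖x‖ₑ ^ (q - p) * ∫⁻ t, ‖Y t‖ₑ ^ p ∂ν + ∫⁻ t, ‖Y t‖ₑ ^ q ∂ν) := by
  have hYm := hY.aemeasurable
  have := Measure.isProbabilityMeasure_map (μ := ν) hYm
  have h := hΦ.lintegral_add_le (ν.map Y)
    ((integrable_map_measure aestronglyMeasurable_id hYm).2 hY)
    ((integral_map hYm aestronglyMeasurable_id).trans hmean) x
  have hm := hΦ.measurable
  rwa [lintegral_map' (by fun_prop) hYm, lintegral_map' (by fun_prop) hYm,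
    lintegral_map' (by fun_prop) hYm] at h

/-- One step of the martingale recursion for the mean of the potential. -/
lemma IsPotential.lintegral_martingale_step_le (hΦ : IsPotential p q Φ c) (hp : 1 < p)
    (hpq : p ≤ q) {X T : Type*}
    [MeasurableSpace X] [MeasurableSpace T] {ρ : Measure X} {ν : Measure T}
    [IsProbabilityMeasure ρ] [IsProbabilityMeasure ν] {W : X → B} {D : X → T → B}
    (hW : Measurable W) (hD : Measurable (Function.uncurry D))
    (hmean : ∀ᵐ x ∂ρ, Integrable (D x) ν ∧ ∫ t, D x t ∂ν = 0) {w : ℝ≥0∞}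
    (hw : ∫⁻ x, ∫⁻ t, ‖D x t‖ₑ ^ q ∂ν ∂ρ ≤ w) :
    ∫⁻ x, ∫⁻ t, Φ (W x + D x t) ∂ν ∂ρ ≤ ∫⁻ x, Φ (W x) ∂ρ +
      c * c * ((∫⁻ x, Φ (W x) ∂ρ) ^ (1 - 1 / (q / p)) * w ^ (1 / (q / p)) + w) := by
  have hp0 : 0 < p := by linarith
  have hq0 : 0 < q := by linarith
  have hc1 := hΦ.one_le
  have hpq1 : p / q ≤ 1 := (div_le_one hq0).2 hpq
  have hm := hΦ.measurable
  have hcc : c ≤ c * c := le_mul_of_one_le_left zero_le hc1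
  -- Hölder on the product space with weights `1 - p / q` and `p / q` separates the past from the
  -- increment, whose `p`-th moment may depend on the past.
  have holder : ∫⁻ x, ‖W x‖ₑ ^ (q - p) * ∫⁻ t, ‖D x t‖ₑ ^ p ∂ν ∂ρ ≤
      (∫⁻ x, ‖W x‖ₑ ^ q ∂ρ) ^ (1 - p / q) * w ^ (p / q) := by
    have h := ENNReal.lintegral_mul_norm_pow_le (μ := ρ.prod ν)
      (f := fun z => ‖W z.1‖ₑ ^ q) (g := fun z => ‖D z.1 z.2‖ₑ ^ q)
      ((hW.comp measurable_fst).enorm.pow_const q).aemeasurable (hD.enorm.pow_const q).aemeasurable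
      (p := 1 - p / q) (q := p / q) (by linarith) (by positivity) (by ring)
    simp only [← ENNReal.rpow_mul] at h
    have e1 : q * (1 - p / q) = q - p := by field_simp
    have e2 : q * (p / q) = p := by field_simp
    rw [e1, e2] at h
    have mW : Measurable fun z : X × T => ‖W z.1‖ₑ := (hW.comp measurable_fst).enorm
    have mD : Measurable fun z : X × T => ‖D z.1 z.2‖ₑ := hD.enorm
    have mDx : ∀ x, Measurable fun t => ‖D x t‖ₑ := fun x => mD.comp measurable_prodMk_left
    rw [lintegral_prod _ (by fun_prop), lintegral_prod _ (by fun_prop),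
      lintegral_prod _ (by fun_prop)] at h
    simp only [lintegral_const, measure_univ, mul_one] at h
    calc _ = ∫⁻ x, ∫⁻ t, ‖W x‖ₑ ^ (q - p) * ‖D x t‖ₑ ^ p ∂ν ∂ρ := by
          refine lintegral_congr fun x => ?_
          rw [lintegral_const_mul _ ((mDx x).pow_const p)]
      _ ≤ _ := h
      _ ≤ _ := by gcongr
  have hWΦ : (∫⁻ x, ‖W x‖ₑ ^ q ∂ρ) ^ (1 - p / q) ≤ c * (∫⁻ x, Φ (W x) ∂ρ) ^ (1 - p / q) := by
    calc _ ≤ (c * ∫⁻ x, Φ (W x) ∂ρ) ^ (1 - p / q) := by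
          refine ENNReal.rpow_le_rpow ?_ (by linarith)
          rw [← lintegral_const_mul _ (by fun_prop)]
          exact lintegral_mono fun x => hΦ.enorm_rpow_le _
      _ = c ^ (1 - p / q) * (∫⁻ x, Φ (W x) ∂ρ) ^ (1 - p / q) :=
        ENNReal.mul_rpow_of_nonneg _ _ (by linarith)
      _ ≤ c ^ (1 : ℝ) * (∫⁻ x, Φ (W x) ∂ρ) ^ (1 - p / q) := by
        have : 0 ≤ p / q := by positivity
        gcongr ?_ * _
        exact ENNReal.rpow_le_rpow_of_exponent_le hc1 (by linarith)
      _ = _ := by rw [ENNReal.rpow_one]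
  have mp : Measurable fun x => ∫⁻ t, ‖D x t‖ₑ ^ p ∂ν :=
    Measurable.lintegral_prod_right (hD.enorm.pow_const p)
  have mq : Measurable fun x => ∫⁻ t, ‖D x t‖ₑ ^ q ∂ν :=
    Measurable.lintegral_prod_right (hD.enorm.pow_const q)
  have e3 : 1 / (q / p) = p / q := by field_simp
  rw [e3]
  calc _ ≤ ∫⁻ x, (Φ (W x) + c * (‖W x‖ₑ ^ (q - p) * ∫⁻ t, ‖D x t‖ₑ ^ p ∂ν
          + ∫⁻ t, ‖D x t‖ₑ ^ q ∂ν)) ∂ρ := by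
        refine lintegral_mono_ae ?_
        filter_upwards [hmean] with x hx using hΦ.lintegral_comp_add_le hx.1 hx.2 _
    _ = ∫⁻ x, Φ (W x) ∂ρ + c * (∫⁻ x, ‖W x‖ₑ ^ (q - p) * ∫⁻ t, ‖D x t‖ₑ ^ p ∂ν ∂ρ
          + ∫⁻ x, ∫⁻ t, ‖D x t‖ₑ ^ q ∂ν ∂ρ) := by
        rw [lintegral_add_left (by fun_prop), lintegral_const_mul _ (by fun_prop),
          lintegral_add_left (by fun_prop)]
    _ ≤ ∫⁻ x, Φ (W x) ∂ρ + c * (c * (∫⁻ x, Φ (W x) ∂ρ) ^ (1 - p / q) * w ^ (p / q)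
          + c * w) := by
        gcongr
        · exact holder.trans (by gcongr)
        · exact hw.trans (le_mul_of_one_le_left zero_le hc1)
    _ = _ := by ring

/-- Rosenthal's inequality for sums of independent centered random vectors. -/
lemma IsPotential.lintegral_enorm_sum_rpow_le (hΦ : IsPotential p q Φ c) (hp : 1 < p) (hpq : p ≤ q)
    {Ω ι : Type*} [MeasurableSpace Ω] {μ : Measure Ω} [IsProbabilityMeasure μ]
    {Y : ι → Ω → B} (hind : iIndepFun Y μ) (hint : ∀ i, Integrable (Y i) μ)
    (hmean : ∀ i, ∫ ω, Y i ω ∂μ = 0) (I : Finset ι) :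
    ∫⁻ ω, ‖∑ i ∈ I, Y i ω‖ₑ ^ q ∂μ ≤
      c * ((2 * (c * c) * ∑ i ∈ I, ∫⁻ ω, ‖Y i ω‖ₑ ^ p ∂μ) ^ (q / p)
        + 2 * (c * c) * ∑ i ∈ I, ∫⁻ ω, ‖Y i ω‖ₑ ^ q ∂μ) := by
  classical
  have hp0 : 0 < p := by linarith
  have hq0 : 0 < q := by linarith
  have hc1 := hΦ.one_le
  have hm := hΦ.measurable
  have hpq1 : p / q ≤ 1 := (div_le_one hq0).2 hpq
  have hY : ∀ i, AEMeasurable (Y i) μ := fun i => (hint i).aemeasurable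
  have hS : ∀ t : Finset ι, AEMeasurable (fun ω => ∑ i ∈ t, Y i ω) μ := fun t => by
    fun_prop
  have hΦS : ∀ t : Finset ι, AEMeasurable (fun ω => Φ (∑ i ∈ t, Y i ω)) μ := fun t =>
    hm.comp_aemeasurable (hS t)
  -- The summands are adjoined one by one, each new one being independent of the partial sum.
  have key := finset_recursion_le (s := q / p) ((one_le_div hp0).2 hpq) I
    (fun t => ∫⁻ ω, Φ (∑ i ∈ t, Y i ω) ∂μ) (fun i => ∫⁻ ω, ‖Y i ω‖ₑ ^ p ∂μ)
    (fun i => ∫⁻ ω, ‖Y i ω‖ₑ ^ q ∂μ) (C := c * c) (one_le_mul hc1 hc1)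
    (ENNReal.mul_ne_top hΦ.ne_top hΦ.ne_top) (by simp [hΦ.map_zero hq0]) ?_
  · calc _ ≤ ∫⁻ ω, c * Φ (∑ i ∈ I, Y i ω) ∂μ := lintegral_mono fun ω => hΦ.enorm_rpow_le _
      _ = c * ∫⁻ ω, Φ (∑ i ∈ I, Y i ω) ∂μ :=
        lintegral_const_mul'' _ (hΦS I)
      _ ≤ _ := by gcongr
  · intro i t hi _
    have hindep : IndepFun (fun ω => ∑ j ∈ t, Y j ω) (Y i) μ := by
      have := hind.indepFun_finsetSum_of_notMem₀ hY hi
      convert this using 1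
      ext ω; simp
    have hlaw := hindep.map_prod_eq_prod_map_map (hS t) (hY i)
    have := Measure.isProbabilityMeasure_map (μ := μ) (hS t)
    have h1 : ∫⁻ ω, Φ (∑ j ∈ insert i t, Y j ω) ∂μ =
        ∫⁻ ω, ∫⁻ ω', Φ (∑ j ∈ t, Y j ω + Y i ω') ∂μ ∂μ := by
      have h2 : ∫⁻ ω, Φ (∑ j ∈ insert i t, Y j ω) ∂μ =
          ∫⁻ z, Φ (z.1 + z.2) ∂(μ.map fun ω => (∑ j ∈ t, Y j ω, Y i ω)) := by
        rw [lintegral_map' (by fun_prop) ((hS t).prodMk (hY i))]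
        refine lintegral_congr fun ω => ?_
        rw [Finset.sum_insert hi, add_comm]
      have := Measure.isProbabilityMeasure_map (μ := μ) (hY i)
      rw [h2, hlaw, lintegral_prod _ (by fun_prop), lintegral_map' (by fun_prop) (hS t)]
      refine lintegral_congr fun ω => ?_
      rw [lintegral_map' (by fun_prop) (hY i)]
    -- By independence the mixed term factors, so Jensen for the partial sum is enough and the
    -- `p`-th moment of the new summand survives unchanged.
    have h3 : ∫⁻ ω, ‖∑ j ∈ t, Y j ω‖ₑ ^ (q - p) ∂μ ≤
        c * (∫⁻ ω, Φ (∑ j ∈ t, Y j ω) ∂μ) ^ (1 - p / q) := by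
      have e : ∀ x : B, ‖x‖ₑ ^ (q - p) = (‖x‖ₑ ^ q) ^ (1 - p / q) := fun x => by
        rw [← ENNReal.rpow_mul]; congr 1; field_simp
      have hpos : 0 ≤ p / q := by positivity
      calc _ = ∫⁻ ω, (‖∑ j ∈ t, Y j ω‖ₑ ^ q) ^ (1 - p / q) ∂μ := by simp only [e]
        _ ≤ (∫⁻ ω, ‖∑ j ∈ t, Y j ω‖ₑ ^ q ∂μ) ^ (1 - p / q) :=
          lintegral_rpow_le_rpow_lintegral ((hS t).enorm.pow_const q) (by linarith) (by linarith)
        _ ≤ (c * ∫⁻ ω, Φ (∑ j ∈ t, Y j ω) ∂μ) ^ (1 - p / q) := by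
          refine ENNReal.rpow_le_rpow ?_ (by linarith)
          rw [← lintegral_const_mul'' _ (hΦS t)]
          exact lintegral_mono fun x => hΦ.enorm_rpow_le _
        _ = c ^ (1 - p / q) * (∫⁻ ω, Φ (∑ j ∈ t, Y j ω) ∂μ) ^ (1 - p / q) :=
          ENNReal.mul_rpow_of_nonneg _ _ (by linarith)
        _ ≤ c ^ (1 : ℝ) * (∫⁻ ω, Φ (∑ j ∈ t, Y j ω) ∂μ) ^ (1 - p / q) := by
          gcongr ?_ * _
          exact ENNReal.rpow_le_rpow_of_exponent_le hc1 (by linarith)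
        _ = _ := by rw [ENNReal.rpow_one]
    have e3 : 1 / (q / p) = p / q := by field_simp
    rw [h1, e3]
    calc _ ≤ ∫⁻ ω, (Φ (∑ j ∈ t, Y j ω) + c * (‖∑ j ∈ t, Y j ω‖ₑ ^ (q - p)
            * ∫⁻ ω', ‖Y i ω'‖ₑ ^ p ∂μ + ∫⁻ ω', ‖Y i ω'‖ₑ ^ q ∂μ)) ∂μ :=
          lintegral_mono fun ω => hΦ.lintegral_comp_add_le (hint i) (hmean i) _
      _ = ∫⁻ ω, Φ (∑ j ∈ t, Y j ω) ∂μ + c * ((∫⁻ ω, ‖∑ j ∈ t, Y j ω‖ₑ ^ (q - p) ∂μ)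
            * ∫⁻ ω', ‖Y i ω'‖ₑ ^ p ∂μ + ∫⁻ ω', ‖Y i ω'‖ₑ ^ q ∂μ) := by
          have a1 : AEMeasurable (fun ω => ‖∑ j ∈ t, Y j ω‖ₑ ^ (q - p)) μ :=
            (hS t).enorm.pow_const _
          rw [lintegral_add_left' (hΦS t),
            lintegral_const_mul'' _ ((a1.mul_const _).add_const _),
            lintegral_add_left' (a1.mul_const _), lintegral_mul_const'' _ a1]
          simp
      _ ≤ ∫⁻ ω, Φ (∑ j ∈ t, Y j ω) ∂μ + c * ((c * (∫⁻ ω, Φ (∑ j ∈ t, Y j ω) ∂μ) ^ (1 - p / q))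
            * ∫⁻ ω', ‖Y i ω'‖ₑ ^ p ∂μ + c * ∫⁻ ω', ‖Y i ω'‖ₑ ^ q ∂μ) := by
          gcongr
          exact le_mul_of_one_le_left zero_le hc1
      _ = _ := by ring

end IncompleteUStat

/-! ### Sums over increasing tuples and their first variable -/

namespace IncompleteUStat

open scoped ENNReal NNReal

variable {S B : Type*} [NormedAddCommGroup B]

open Classical in
/-- The sum of `h (x_{i_1}, …, x_{i_m})` over all `i_1 < ⋯ < i_m` in `Fin n`. -/
noncomputable def kernelSum (m n : ℕ) (h : (Fin m → S) → B) (x : Fin n → S) : B :=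
  ∑ f : Fin m → Fin n with StrictMono f, h (x ∘ f)

/-- The section of a kernel at a value of its first argument. -/
def section₀ {m : ℕ} (h : (Fin (m + 1) → S) → B) (t : S) (y : Fin m → S) : B :=
  h (Fin.cons t y)

/-- The mean of a kernel over its first argument. -/
noncomputable def mean₀ [NormedSpace ℝ B] [MeasurableSpace S] (ν : Measure S) {m : ℕ}
    (h : (Fin (m + 1) → S) → B) (y : Fin m → S) : B :=
  ∫ t, section₀ h t y ∂ν

lemma kernelSum_zero_left (n : ℕ) (h : (Fin 0 → S) → B) (x : Fin n → S) :
    kernelSum 0 n h x = h default := by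
  rw [kernelSum, Finset.filter_true_of_mem fun f _ => Subsingleton.strictMono f,
    Fintype.sum_unique]
  congr 1
  exact Subsingleton.elim _ _

lemma kernelSum_succ_zero (m : ℕ) (h : (Fin (m + 1) → S) → B) (x : Fin 0 → S) :
    kernelSum (m + 1) 0 h x = 0 := by
  rw [kernelSum]
  exact Finset.sum_eq_zero fun f _ => (f 0).elim0

/-- Only the first entry of an increasing tuple can be the index `0`. The tuples avoiding `0`
involve only the tail of `x`; those starting at `0` give a sum of the section at `x 0`. Hence `x 0`
acts as the newly revealed variable and the tail as the past. -/
lemma kernelSum_succ_succ (m n : ℕ) (h : (Fin (m + 1) → S) → B) (x : Fin (n + 1) → S) :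
    kernelSum (m + 1) (n + 1) h x =
      kernelSum (m + 1) n h (Fin.tail x) + kernelSum m n (section₀ h (x 0)) (Fin.tail x) := by
  classical
  have inj1 : Function.Injective fun (g : Fin (m + 1) → Fin n) (k : Fin (m + 1)) => (g k).succ :=
    fun g g' hg => funext fun k => Fin.succ_injective _ (congrFun hg k)
  have inj2 : Function.Injective fun (g : Fin m → Fin n) =>
      (Fin.cons 0 (fun k => (g k).succ) : Fin (m + 1) → Fin (n + 1)) := by
    intro g g' hg
    funext k
    have := congrFun hg k.succ
    simpa using this
  have hsplit : ({f : Fin (m + 1) → Fin (n + 1) | StrictMono f} : Finset _) =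
      ({g : Fin (m + 1) → Fin n | StrictMono g} : Finset _).image
        (fun g k => (g k).succ) ∪
      ({g : Fin m → Fin n | StrictMono g} : Finset _).image
        (fun g => (Fin.cons 0 (fun k => (g k).succ) : Fin (m + 1) → Fin (n + 1))) := by
    ext f
    simp only [Finset.mem_filter, Finset.mem_univ, true_and, Finset.mem_union, Finset.mem_image]
    constructor
    · intro hf
      by_cases h0 : f 0 = 0
      · right
        have hpos : ∀ k : Fin m, f k.succ ≠ 0 := fun k hk => by
          have := hf (Fin.succ_pos k)
          rw [h0, hk] at this
          exact lt_irrefl _ this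
        refine ⟨fun k => (f k.succ).pred (hpos k), fun a b hab => ?_, ?_⟩
        · rw [Fin.pred_lt_pred_iff]
          exact hf (Fin.succ_lt_succ_iff.2 hab)
        · funext k
          refine Fin.cases ?_ (fun k => ?_) k
          · simp [h0]
          · simp
      · left
        have hpos : ∀ k, f k ≠ 0 := fun k hk => by
          have := hf.monotone (Fin.zero_le k)
          rw [hk] at this
          exact h0 (le_antisymm this (Fin.zero_le _))
        exact ⟨fun k => (f k).pred (hpos k), fun a b hab => Fin.pred_lt_pred_iff.2 (hf hab),
          by funext k; simp⟩
    · rintro (⟨g, hg, rfl⟩ | ⟨g, hg, rfl⟩)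
      · exact fun a b hab => Fin.succ_lt_succ_iff.2 (hg hab)
      · intro a b hab
        induction b using Fin.cases with
        | zero => exact absurd hab (Fin.not_lt_zero a)
        | succ b =>
          induction a using Fin.cases with
          | zero => simp
          | succ a =>
            simp only [Fin.cons_succ]
            exact Fin.succ_lt_succ_iff.2 (hg (Fin.succ_lt_succ_iff.1 hab))
  have hdisj : Disjoint (({g : Fin (m + 1) → Fin n | StrictMono g} : Finset _).image
        (fun g k => (g k).succ))
      (({g : Fin m → Fin n | StrictMono g} : Finset _).image
        (fun g => (Fin.cons 0 (fun k => (g k).succ) : Fin (m + 1) → Fin (n + 1)))) := by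
    rw [Finset.disjoint_left]
    intro f hf hf'
    simp only [Finset.mem_image] at hf hf'
    obtain ⟨g, -, rfl⟩ := hf
    obtain ⟨g', -, hg'⟩ := hf'
    have := congrFun hg' 0
    exact Fin.succ_ne_zero (g 0) this.symm
  have e2 : ∀ g : Fin m → Fin n, x ∘ (Fin.cons 0 (fun k => (g k).succ) : Fin (m + 1) → Fin (n + 1))
      = Fin.cons (x 0) (Fin.tail x ∘ g) := fun g => by
    funext k
    refine Fin.cases ?_ (fun k => ?_) k
    · simp
    · simp [Fin.tail]
  rw [kernelSum, hsplit, Finset.sum_union hdisj, Finset.sum_image inj1.injOn,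
    Finset.sum_image inj2.injOn, kernelSum, kernelSum]
  simp only [e2, section₀]
  rfl

lemma kernelSum_sub (m n : ℕ) (h g : (Fin m → S) → B) (x : Fin n → S) :
    kernelSum m n (fun y => h y - g y) x = kernelSum m n h x - kernelSum m n g x := by
  simp [kernelSum, Finset.sum_sub_distrib]

section Measurability

variable [MeasurableSpace S] [MeasurableSpace B] [BorelSpace B] [SecondCountableTopology B]

lemma measurable_cons (m : ℕ) :
    Measurable fun z : S × (Fin m → S) => (Fin.cons z.1 z.2 : Fin (m + 1) → S) := by
  refine measurable_pi_lambda _ fun k => ?_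
  refine Fin.cases ?_ (fun k => ?_) k
  · simpa using measurable_fst
  · simp only [Fin.cons_succ]
    exact (measurable_pi_apply k).comp measurable_snd

lemma measurable_tail (m : ℕ) : Measurable fun z : Fin (m + 1) → S => Fin.tail z :=
  measurable_pi_lambda _ fun k => measurable_pi_apply k.succ

lemma measurable_kernelSum_param {T : Type*} [MeasurableSpace T] {m n : ℕ}
    {H : T → (Fin m → S) → B} (hH : Measurable (Function.uncurry H)) :
    Measurable fun z : T × (Fin n → S) => kernelSum m n (H z.1) z.2 := by
  simp only [kernelSum]
  refine Finset.measurable_fun_sum _ fun f _ => ?_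
  refine hH.comp (measurable_fst.prodMk (measurable_pi_lambda _ fun k => ?_))
  exact (measurable_pi_apply (f k)).comp measurable_snd

lemma measurable_kernelSum {m n : ℕ} {h : (Fin m → S) → B} (hh : Measurable h) :
    Measurable (kernelSum m n h) := by
  have : Measurable fun z : Unit × (Fin n → S) => kernelSum m n h z.2 :=
    measurable_kernelSum_param (H := fun _ : Unit => h) (hh.comp measurable_snd)
  exact this.comp (measurable_prodMk_left (x := ()))

omit [NormedAddCommGroup B] [BorelSpace B] [SecondCountableTopology B] in
lemma measurable_uncurry_section₀ {m : ℕ} {h : (Fin (m + 1) → S) → B} (hh : Measurable h) :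
    Measurable (Function.uncurry (section₀ h)) :=
  hh.comp (measurable_cons m)

lemma measurable_mean₀ [NormedSpace ℝ B] {ν : Measure S} [SFinite ν] {m : ℕ}
    {h : (Fin (m + 1) → S) → B} (hh : Measurable h) : Measurable (mean₀ ν h) :=
  (StronglyMeasurable.integral_prod_left'
    (measurable_uncurry_section₀ hh).stronglyMeasurable).measurable

end Measurability

section ProductMeasure

variable [MeasurableSpace S] (ν : Measure S) [IsProbabilityMeasure ν]

lemma measurePreserving_cons (m : ℕ) :
    MeasurePreserving (fun z : S × (Fin m → S) => (Fin.cons z.1 z.2 : Fin (m + 1) → S))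
      (ν.prod (Measure.pi fun _ => ν)) (Measure.pi fun _ => ν) := by
  have := (measurePreserving_piFinSuccAbove (fun _ : Fin (m + 1) => ν) 0).symm
  convert this using 1
  funext z
  simp [MeasurableEquiv.piFinSuccAbove, Fin.consEquiv]

lemma measurePreserving_tail (m : ℕ) :
    MeasurePreserving (fun z : Fin (m + 1) → S => Fin.tail z)
      (Measure.pi fun _ => ν) (Measure.pi fun _ => ν) := by
  have h := (measurePreserving_snd (μ := ν) (ν := Measure.pi fun _ : Fin m => ν)).comp
    (measurePreserving_piFinSuccAbove (fun _ : Fin (m + 1) => ν) 0)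
  convert h using 1
  funext z k
  simp [MeasurableEquiv.piFinSuccAbove, Fin.tail]

lemma measurePreserving_comp_of_injective {κ ι : Type*} [Fintype κ] [Fintype ι] {f : κ → ι}
    (hf : Function.Injective f) :
    MeasurePreserving (fun x : ι → S => x ∘ f) (Measure.pi fun _ => ν) (Measure.pi fun _ => ν) := by
  refine ⟨measurable_pi_lambda _ fun k => measurable_pi_apply (f k), ?_⟩
  have h1 : iIndepFun (fun (i : ι) (x : ι → S) => x i) (Measure.pi fun _ => ν) :=
    iIndepFun_pi (X := fun _ => id) fun _ => aemeasurable_id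
  have h2 := (iIndepFun_iff_map_fun_eq_pi_map
    fun k => (measurable_pi_apply (f k)).aemeasurable).1 (h1.precomp hf)
  have h3 : ∀ i : ι, (Measure.pi fun _ => ν).map (fun x : ι → S => x i) = ν :=
    fun i => (measurePreserving_eval (fun _ : ι => ν) i).map_eq
  simp only [h3] at h2
  exact h2

variable {ν}

lemma lintegral_pi_succ {m : ℕ} {F : (Fin (m + 1) → S) → ℝ≥0∞} (hF : Measurable F) :
    ∫⁻ z, F z ∂(Measure.pi fun _ => ν) =
      ∫⁻ x, ∫⁻ t, F (Fin.cons t x) ∂ν ∂(Measure.pi fun _ => ν) := by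
  rw [← (measurePreserving_cons ν m).lintegral_comp hF,
    lintegral_prod_symm' (fun z : S × (Fin m → S) => F (Fin.cons z.1 z.2))
      (hF.comp (measurable_cons m))]

lemma lintegral_pi_succ' {m : ℕ} {F : (Fin (m + 1) → S) → ℝ≥0∞} (hF : Measurable F) :
    ∫⁻ z, F z ∂(Measure.pi fun _ => ν) =
      ∫⁻ t, ∫⁻ x, F (Fin.cons t x) ∂(Measure.pi fun _ => ν) ∂ν := by
  rw [← (measurePreserving_cons ν m).lintegral_comp hF,
    lintegral_prod (fun z : S × (Fin m → S) => F (Fin.cons z.1 z.2))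
      (hF.comp (measurable_cons m)).aemeasurable]

lemma ae_integrable_section₀ {m : ℕ} {h : (Fin (m + 1) → S) → B}
    (hint : Integrable h (Measure.pi fun _ => ν)) :
    ∀ᵐ y ∂(Measure.pi fun _ => ν), Integrable (fun t => section₀ h t y) ν :=
  ((measurePreserving_cons ν m).integrable_comp_of_integrable hint).prod_left_ae

/-- This computes the conditional mean, given the past, of the contribution of a new variable.
Selecting coordinates along an injective map preserves product measure, so the null set of bad
sections pulls back to a null set for each of the finitely many tuples. -/
lemma ae_integral_kernelSum_section₀ [NormedSpace ℝ B] {m : ℕ} (n : ℕ) {h : (Fin (m + 1) → S) → B}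
    (hint : Integrable h (Measure.pi fun _ => ν)) :
    ∀ᵐ x ∂(Measure.pi fun _ => ν), Integrable (fun t => kernelSum m n (section₀ h t) x) ν ∧
      ∫ t, kernelSum m n (section₀ h t) x ∂ν = kernelSum m n (mean₀ ν h) x := by
  have : ∀ᵐ x ∂(Measure.pi fun _ : Fin n => ν), ∀ f : Fin m → Fin n, StrictMono f →
      Integrable (fun t => section₀ h t (x ∘ f)) ν := by
    rw [ae_all_iff]
    intro f
    by_cases hf : StrictMono f
    · have := (measurePreserving_comp_of_injective ν hf.injective).quasiMeasurePreserving.ae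
        (ae_integrable_section₀ hint)
      filter_upwards [this] with x hx _ using hx
    · exact ae_of_all _ fun x h => absurd h hf
  filter_upwards [this] with x hx
  simp only [kernelSum]
  constructor
  · exact integrable_finsetSum _ fun f hf => hx f (Finset.mem_filter.1 hf).2
  · rw [integral_finsetSum _ fun f hf => hx f (Finset.mem_filter.1 hf).2]
    rfl

end ProductMeasure

end IncompleteUStat

/-! ### Moment bounds after removing one argument -/

namespace IncompleteUStat

open scoped ENNReal NNReal

variable {S B : Type*} [NormedAddCommGroup B] [NormedSpace ℝ B]
  [MeasurableSpace B] [BorelSpace B] [SecondCountableTopology B]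
  [MeasurableSpace S] {ν : Measure S} [IsProbabilityMeasure ν]
  {p q : ℝ} {Φ : B → ℝ≥0∞} {c : ℝ≥0∞}

omit [SecondCountableTopology B] in
lemma lintegral_enorm_mean₀_rpow_le (hq : 1 ≤ q) {m : ℕ} {h : (Fin (m + 1) → S) → B}
    (hh : Measurable h) :
    ∫⁻ y, ‖mean₀ ν h y‖ₑ ^ q ∂(Measure.pi fun _ => ν) ≤
      ∫⁻ y, ‖h y‖ₑ ^ q ∂(Measure.pi fun _ => ν) := by
  rw [lintegral_pi_succ (hh.enorm.pow_const q)]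
  refine lintegral_mono fun y => ?_
  have hm : Measurable fun t => section₀ h t y :=
    (measurable_uncurry_section₀ hh).comp measurable_prodMk_right
  calc ‖mean₀ ν h y‖ₑ ^ q ≤ (∫⁻ t, ‖section₀ h t y‖ₑ ∂ν) ^ q :=
        ENNReal.rpow_le_rpow (enorm_integral_le_lintegral_enorm _) (by linarith)
    _ ≤ _ := rpow_lintegral_le_lintegral_rpow hm.enorm.aemeasurable hq

omit [NormedSpace ℝ B] in
/-- Moment bound for sums of sections of a kernel by means of the triangle inequality. -/
lemma lintegral_enorm_kernelSum_succ_rpow_le (hq : 1 ≤ q) {m n : ℕ} {h : (Fin (m + 1) → S) → B}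
    (hh : Measurable h) {A : ℝ≥0∞}
    (hA : ∀ k < n, ∫⁻ t, ∫⁻ x, ‖kernelSum m k (section₀ h t) x‖ₑ ^ q
      ∂(Measure.pi fun _ => ν) ∂ν ≤ A) :
    ∫⁻ x, ‖kernelSum (m + 1) n h x‖ₑ ^ q ∂(Measure.pi fun _ => ν) ≤ (n : ℝ≥0∞) ^ q * A := by
  have hq0 : 0 < q := by linarith
  have hsec : ∀ k, Measurable fun z : S × (Fin k → S) => kernelSum m k (section₀ h z.1) z.2 :=
    fun k => measurable_kernelSum_param (measurable_uncurry_section₀ hh)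
  -- Minkowski's inequality in `L^q`: each new variable adds at most `A ^ (1 / q)` to the norm.
  have key : ∀ k ≤ n, (∫⁻ x, ‖kernelSum (m + 1) k h x‖ₑ ^ q ∂(Measure.pi fun _ => ν)) ^ (1 / q)
      ≤ k * A ^ (1 / q) := by
    intro k
    induction k with
    | zero => simp [kernelSum_succ_zero, ENNReal.zero_rpow_of_pos hq0,
        inv_pos.2 hq0]
    | succ k ih =>
      intro hk
      have m1 : Measurable fun z : Fin (k + 1) → S => ‖kernelSum (m + 1) k h (Fin.tail z)‖ₑ :=
        ((measurable_kernelSum hh).comp (measurable_tail k)).enorm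
      have m2 : Measurable fun z : Fin (k + 1) → S =>
          ‖kernelSum m k (section₀ h (z 0)) (Fin.tail z)‖ₑ :=
        ((hsec k).comp ((measurable_pi_apply 0).prodMk (measurable_tail k))).enorm
      have e1 : ∫⁻ z, ‖kernelSum (m + 1) k h (Fin.tail z)‖ₑ ^ q
          ∂(Measure.pi fun _ : Fin (k + 1) => ν) =
          ∫⁻ x, ‖kernelSum (m + 1) k h x‖ₑ ^ q ∂(Measure.pi fun _ => ν) :=
        (measurePreserving_tail ν k).lintegral_comp
          ((measurable_kernelSum hh).enorm.pow_const q)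
      have e2 : ∫⁻ z, ‖kernelSum m k (section₀ h (z 0)) (Fin.tail z)‖ₑ ^ q
          ∂(Measure.pi fun _ : Fin (k + 1) => ν) ≤ A := by
        rw [lintegral_pi_succ' (m2.pow_const q)]
        simpa using hA k (by omega)
      calc _ ≤ (∫⁻ z, (‖kernelSum (m + 1) k h (Fin.tail z)‖ₑ +
              ‖kernelSum m k (section₀ h (z 0)) (Fin.tail z)‖ₑ) ^ q
              ∂(Measure.pi fun _ : Fin (k + 1) => ν)) ^ (1 / q) := by
            gcongr with z
            rw [kernelSum_succ_succ]
            exact enorm_add_le _ _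
        _ ≤ _ := ENNReal.lintegral_Lp_add_le m1.aemeasurable m2.aemeasurable hq
        _ ≤ k * A ^ (1 / q) + A ^ (1 / q) := by
            rw [e1]
            gcongr
            exact ih (by omega)
        _ = _ := by push_cast; ring
  calc _ = ((∫⁻ x, ‖kernelSum (m + 1) n h x‖ₑ ^ q ∂(Measure.pi fun _ => ν)) ^ (1 / q)) ^ q := by
        rw [← ENNReal.rpow_mul, one_div_mul_cancel hq0.ne', ENNReal.rpow_one]
    _ ≤ (n * A ^ (1 / q)) ^ q := by
        gcongr
        exact key n le_rfl
    _ = _ := by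
        rw [ENNReal.mul_rpow_of_nonneg _ _ hq0.le, ← ENNReal.rpow_mul, one_div_mul_cancel hq0.ne',
          ENNReal.rpow_one]

/-- Moment bound for the sum of the centered sections of a kernel, by martingale methods. -/
lemma IsPotential.lintegral_enorm_kernelSum_sub_mean₀_rpow_le [CompleteSpace B] (hΦ : IsPotential p q Φ c)
    (hp : 1 < p) (hpq : p ≤ q) {m n : ℕ} {h : (Fin (m + 1) → S) → B}
    (hh : Measurable h) (hint : Integrable h (Measure.pi fun _ => ν)) {A : ℝ≥0∞}
    (hA : ∀ k < n, ∫⁻ t, ∫⁻ x, ‖kernelSum m k (section₀ h t) x‖ₑ ^ q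
      ∂(Measure.pi fun _ => ν) ∂ν ≤ A) :
    ∫⁻ x, ‖kernelSum (m + 1) n (fun y => h y - mean₀ ν h (Fin.tail y)) x‖ₑ ^ q
        ∂(Measure.pi fun _ => ν) ≤
      c * ((2 * (c * c)) ^ (q / p) + 2 * (c * c)) * 2 ^ q * ((n : ℝ≥0∞) ^ (q / p) * A) := by
  have hp0 : 0 < p := by linarith
  have hq0 : 0 < q := by linarith
  have hs : 1 ≤ q / p := (one_le_div hp0).2 hpq
  have hs0 : 0 < q / p := by linarith
  set g : (Fin (m + 1) → S) → B := fun y => h y - mean₀ ν h (Fin.tail y) with hg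
  have hgm : Measurable g := hh.sub ((measurable_mean₀ hh).comp (measurable_tail m))
  set U : ℕ → ℝ≥0∞ := fun k => ∫⁻ x, Φ (kernelSum (m + 1) k g x) ∂(Measure.pi fun _ => ν) with hU
  have hsec : ∀ k, Measurable fun z : S × (Fin k → S) => kernelSum m k (section₀ h z.1) z.2 :=
    fun k => measurable_kernelSum_param (measurable_uncurry_section₀ hh)
  have hmean : ∀ k, Measurable (kernelSum m k (mean₀ ν h) : (Fin k → S) → B) :=
    fun k => measurable_kernelSum (measurable_mean₀ hh)
  have hstep : ∀ k < n, U (k + 1) ≤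
      U k + c * c * (U k ^ (1 - 1 / (q / p)) * (2 ^ q * A) ^ (1 / (q / p)) + 2 ^ q * A) := by
    intro k hk
    -- `D x t` is the increment when `t` joins the past `x`. It is centered in `t` for almost every
    -- `x`, and centering multiplies the bound `A` by at most `2 ^ q`.
    set D : (Fin k → S) → S → B :=
      fun x t => kernelSum m k (section₀ h t) x - kernelSum m k (mean₀ ν h) x with hD
    have hDm : Measurable (Function.uncurry D) :=
      ((hsec k).comp measurable_swap).sub ((hmean k).comp measurable_fst)
    have hW := measurable_kernelSum (n := k) hgm
    have hU1 : U (k + 1) = ∫⁻ x, ∫⁻ t, Φ (kernelSum (m + 1) k g x + D x t) ∂ν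
        ∂(Measure.pi fun _ => ν) := by
      rw [hU]
      simp only []
      have hΦg : Measurable fun z : Fin (k + 1) → S => Φ (kernelSum (m + 1) (k + 1) g z) :=
        hΦ.measurable.comp (measurable_kernelSum hgm)
      rw [lintegral_pi_succ hΦg]
      refine lintegral_congr fun x => lintegral_congr fun t => ?_
      rw [kernelSum_succ_succ, hD]
      simp only [Fin.cons_zero, Fin.tail_cons]
      rw [← kernelSum_sub]
      congr 3
    rw [hU1]
    refine hΦ.lintegral_martingale_step_le hp hpq hW hDm ?_ ?_
    · filter_upwards [ae_integral_kernelSum_section₀ k hint] with x hx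
      refine ⟨hx.1.sub (integrable_const _), ?_⟩
      rw [hD, integral_sub hx.1 (integrable_const _), hx.2]
      simp
    · have hx2 : ∀ x, Measurable fun t => kernelSum m k (section₀ h t) x := fun x =>
        (hsec k).comp measurable_prodMk_right
      have msec : Measurable fun x : Fin k → S => ∫⁻ t, ‖kernelSum m k (section₀ h t) x‖ₑ ^ q ∂ν :=
        Measurable.lintegral_prod_right' (f := fun z : (Fin k → S) × S =>
          ‖kernelSum m k (section₀ h z.2) z.1‖ₑ ^ q)
          (((hsec k).comp measurable_swap).enorm.pow_const q)
      have hA' : ∫⁻ x, ∫⁻ t, ‖kernelSum m k (section₀ h t) x‖ₑ ^ q ∂ν ∂(Measure.pi fun _ => ν)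
          ≤ A := by
        rw [lintegral_lintegral_swap]
        · exact hA k hk
        · exact (((hsec k).comp measurable_swap).enorm.pow_const q).aemeasurable
      calc _ ≤ ∫⁻ x, 2 ^ (q - 1) * (∫⁻ t, ‖kernelSum m k (section₀ h t) x‖ₑ ^ q ∂ν
            + ∫⁻ t, ‖kernelSum m k (section₀ h t) x‖ₑ ^ q ∂ν) ∂(Measure.pi fun _ => ν) := by
            refine lintegral_mono_ae ?_
            filter_upwards [ae_integral_kernelSum_section₀ k hint] with x hx
            calc _ ≤ ∫⁻ t, 2 ^ (q - 1) * (‖kernelSum m k (section₀ h t) x‖ₑ ^ q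
                  + ‖kernelSum m k (mean₀ ν h) x‖ₑ ^ q) ∂ν :=
                  lintegral_mono fun t => enorm_sub_rpow_le (hp.le.trans hpq) _ _
              _ = 2 ^ (q - 1) * (∫⁻ t, ‖kernelSum m k (section₀ h t) x‖ₑ ^ q ∂ν
                  + ‖kernelSum m k (mean₀ ν h) x‖ₑ ^ q) := by
                  have := ((hx2 x).enorm.pow_const q)
                  rw [lintegral_const_mul _ (this.add_const _), lintegral_add_left this]
                  simp
              _ ≤ _ := by
                  gcongr
                  rw [← hx.2]
                  calc _ ≤ (∫⁻ t, ‖kernelSum m k (section₀ h t) x‖ₑ ∂ν) ^ q :=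
                        ENNReal.rpow_le_rpow (enorm_integral_le_lintegral_enorm _) hq0.le
                    _ ≤ _ := rpow_lintegral_le_lintegral_rpow (hx2 x).enorm.aemeasurable
                        (hp.le.trans hpq)
        _ ≤ 2 ^ (q - 1) * (A + A) := by
            rw [lintegral_const_mul _ (by fun_prop), lintegral_add_left msec]
            gcongr
        _ = 2 ^ q * A := by
            rw [← two_mul, ← mul_assoc]
            congr 1
            nth_rewrite 2 [← ENNReal.rpow_one 2]
            rw [← ENNReal.rpow_add _ _ (by norm_num) (by norm_num)]
            ring_nf
  -- The recursion runs over the number of variables, so a subset is seen only through its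
  -- cardinality.
  have key := finset_recursion_le hs (Finset.range n) (fun t => U t.card)
    (fun _ => (2 ^ q * A) ^ (1 / (q / p))) (fun _ => 2 ^ q * A) (C := c * c)
    (one_le_mul hΦ.one_le hΦ.one_le) (ENNReal.mul_ne_top hΦ.ne_top hΦ.ne_top)
    (by simp [hU, kernelSum_succ_zero, hΦ.map_zero hq0]) (by
      intro i t hi hit
      have hcard := Finset.card_le_card hit
      rw [Finset.card_insert_of_notMem hi, Finset.card_range] at hcard
      rw [Finset.card_insert_of_notMem hi]
      exact hstep _ (by omega))
  simp only [Finset.card_range, Finset.sum_const, nsmul_eq_mul] at key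
  have hns : (n : ℝ≥0∞) ≤ (n : ℝ≥0∞) ^ (q / p) := by
    rcases Nat.eq_zero_or_pos n with rfl | hn
    · simp
    · calc (n : ℝ≥0∞) = (n : ℝ≥0∞) ^ (1 : ℝ) := (ENNReal.rpow_one _).symm
        _ ≤ _ := ENNReal.rpow_le_rpow_of_exponent_le (by exact_mod_cast hn) hs
  calc _ ≤ ∫⁻ x, c * Φ (kernelSum (m + 1) n g x) ∂(Measure.pi fun _ => ν) :=
        lintegral_mono fun x => hΦ.enorm_rpow_le _
    _ = c * U n := lintegral_const_mul _ (hΦ.measurable.comp (measurable_kernelSum hgm))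
    _ ≤ c * ((2 * (c * c) * (n * (2 ^ q * A) ^ (1 / (q / p)))) ^ (q / p)
          + 2 * (c * c) * (n * (2 ^ q * A))) := by gcongr
    _ = c * ((2 * (c * c)) ^ (q / p) * ((n : ℝ≥0∞) ^ (q / p) * (2 ^ q * A))
          + 2 * (c * c) * (n * (2 ^ q * A))) := by
        rw [ENNReal.mul_rpow_of_nonneg (2 * (c * c)) _ hs0.le,
          ENNReal.mul_rpow_of_nonneg (n : ℝ≥0∞) _ hs0.le,
          ← ENNReal.rpow_mul, one_div_mul_cancel hs0.ne', ENNReal.rpow_one]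
    _ ≤ c * ((2 * (c * c)) ^ (q / p) * ((n : ℝ≥0∞) ^ (q / p) * (2 ^ q * A))
          + 2 * (c * c) * ((n : ℝ≥0∞) ^ (q / p) * (2 ^ q * A))) := by gcongr
    _ = _ := by ring

end IncompleteUStat

/-! ### Degeneracy under sections and means -/

namespace IncompleteUStat

open scoped ENNReal NNReal

variable {S B : Type*} [NormedAddCommGroup B] [NormedSpace ℝ B] [MeasurableSpace S]

/-- All conditional expectations of `h` with respect to fewer than `d` of its arguments vanish. -/
def DegenerateKernel (ν : Measure S) {m : ℕ} (d : ℕ) (h : (Fin m → S) → B) : Prop :=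
  ∀ J : Finset (Fin m), J.card < d →
    ∀ᵐ x ∂(Measure.pi fun _ => ν), ∫ y, h (J.piecewise x y) ∂(Measure.pi fun _ => ν) = 0

variable {ν : Measure S} [IsProbabilityMeasure ν]

section Restrict

variable {κ : Type*} [Fintype κ] [DecidableEq κ]

omit [Fintype κ] in
lemma measurable_piecewise (J : Finset κ) :
    Measurable fun z : (κ → S) × (κ → S) => J.piecewise z.1 z.2 := by
  refine measurable_pi_lambda _ fun k => ?_
  by_cases hk : k ∈ J
  · simp only [Finset.piecewise_eq_of_mem _ _ _ hk]
    exact (measurable_pi_apply k).comp measurable_fst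
  · simp only [Finset.piecewise_eq_of_notMem _ _ _ hk]
    exact (measurable_pi_apply k).comp measurable_snd

omit [Fintype κ] in
lemma piecewise_eq_piEquivPiSubtypeProd_symm (J : Finset κ) (x y : κ → S) :
    J.piecewise x y = (MeasurableEquiv.piEquivPiSubtypeProd (fun _ : κ => S) (· ∈ J)).symm
      ((MeasurableEquiv.piEquivPiSubtypeProd (fun _ : κ => S) (· ∈ J) x).1,
        (MeasurableEquiv.piEquivPiSubtypeProd (fun _ : κ => S) (· ∈ J) y).2) := by
  funext k
  by_cases hk : k ∈ J <;>
    simp [MeasurableEquiv.piEquivPiSubtypeProd, Equiv.piEquivPiSubtypeProd, hk]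

lemma measurePreserving_piecewise (J : Finset κ) :
    MeasurePreserving (fun z : (κ → S) × (κ → S) => J.piecewise z.1 z.2)
      ((Measure.pi fun _ => ν).prod (Measure.pi fun _ => ν)) (Measure.pi fun _ => ν) := by
  have h := measurePreserving_piEquivPiSubtypeProd (fun _ : κ => ν) (· ∈ J)
  have h2 := h.symm.comp ((measurePreserving_fst.comp h).prod (measurePreserving_snd.comp h))
  convert h2 using 1
  funext z
  exact piecewise_eq_piEquivPiSubtypeProd_symm J z.1 z.2

end Restrict

omit [MeasurableSpace S] in
lemma cons_piecewise_cons {m : ℕ} (J : Finset (Fin m)) (t s : S) (x y : Fin m → S) :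
    (insert 0 (J.map (Fin.succEmb m))).piecewise
      (Fin.cons t x : Fin (m + 1) → S) (Fin.cons s y) = Fin.cons t (J.piecewise x y) := by
  funext k
  refine Fin.cases ?_ (fun k => ?_) k
  · rw [Finset.piecewise_eq_of_mem _ _ _ (by simp)]; simp
  · by_cases hk : k ∈ J
    · rw [Finset.piecewise_eq_of_mem _ _ _ (by simp [hk])]; simp [hk]
    · rw [Finset.piecewise_eq_of_notMem _ _ _ (by simp [hk])]; simp [hk]

omit [MeasurableSpace S] in
lemma map_piecewise_cons {m : ℕ} (J : Finset (Fin m)) (t s : S) (x y : Fin m → S) :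
    (J.map (Fin.succEmb m)).piecewise
      (Fin.cons t x : Fin (m + 1) → S) (Fin.cons s y) = Fin.cons s (J.piecewise x y) := by
  funext k
  refine Fin.cases ?_ (fun k => ?_) k
  · rw [Finset.piecewise_eq_of_notMem _ _ _ (by simp)]; simp
  · by_cases hk : k ∈ J
    · rw [Finset.piecewise_eq_of_mem _ _ _ (by simp [hk])]; simp [hk]
    · rw [Finset.piecewise_eq_of_notMem _ _ _ (by simp [hk])]; simp [hk]

variable [MeasurableSpace B] [BorelSpace B] [SecondCountableTopology B]

/-- Conditioning the section on `J` amounts to conditioning `h` on its first argument and the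
shifted `J`, one element more; this is why one order is lost. Fubini makes the statement hold for
almost every value of that first argument. -/
lemma DegenerateKernel.ae_section₀ {m d : ℕ} {h : (Fin (m + 1) → S) → B} (hh : Measurable h)
    (hd : DegenerateKernel ν (d + 1) h) : ∀ᵐ t ∂ν, DegenerateKernel ν d (section₀ h t) := by
  rw [DegenerateKernel] at hd
  simp only [DegenerateKernel]
  rw [ae_all_iff]
  intro J
  by_cases hJ : J.card < d
  swap
  · exact ae_of_all _ fun _ h => absurd h hJ
  have h1 := hd (insert 0 (J.map (Fin.succEmb m)))
    ((Finset.card_insert_le _ _).trans_lt (by simpa using hJ))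
  have h2 := (measurePreserving_cons ν m).quasiMeasurePreserving.ae h1
  filter_upwards [Measure.ae_ae_of_ae_prod h2] with t ht _
  filter_upwards [ht] with x hx
  rw [← hx]
  have hm : Measurable fun y => h (Fin.cons t (J.piecewise x y)) :=
    hh.comp ((measurable_cons m).comp (measurable_prodMk_left.comp
      ((measurable_piecewise J).comp measurable_prodMk_left)))
  have e : ∀ w : Fin (m + 1) → S,
      h ((insert 0 (J.map (Fin.succEmb m))).piecewise (Fin.cons t x) w) =
        (fun y => h (Fin.cons t (J.piecewise x y))) (Fin.tail w) := fun w => by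
    have := cons_piecewise_cons J t (w 0) x (Fin.tail w)
    rw [Fin.cons_self_tail] at this
    rw [this]
  simp only [e]
  have h3 := integral_map (μ := Measure.pi fun _ => ν) (measurable_tail m).aemeasurable
    hm.aestronglyMeasurable
  rw [(measurePreserving_tail ν m).map_eq] at h3
  exact h3

/-- Conditioning the mean on `J` is conditioning `h` on the shifted `J`, which omits the first
argument and has the same size; hence no order is lost. -/
lemma DegenerateKernel.mean₀ {m d : ℕ} {h : (Fin (m + 1) → S) → B} (hh : Measurable h)
    (hint : Integrable h (Measure.pi fun _ => ν)) (hd : DegenerateKernel ν d h) :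
    DegenerateKernel ν d (mean₀ ν h) := by
  intro J hJ
  have h1 := hd (J.map (Fin.succEmb m)) (by simpa using hJ)
  have h2 := (measurePreserving_piecewise (ν := ν)
    (J.map (Fin.succEmb m))).integrable_comp_of_integrable hint
  have h3 := (measurePreserving_cons ν m).quasiMeasurePreserving.ae
    (h1.and h2.prod_right_ae)
  -- The first coordinate is integrated out, so the frozen value `t` is a dummy and a single good
  -- one suffices.
  obtain ⟨t, ht⟩ := (Measure.ae_ae_of_ae_prod h3).exists
  filter_upwards [ht] with x hx
  obtain ⟨hx1, hx2⟩ := hx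
  rw [← hx1]
  have hm : Measurable fun w => h ((J.map (Fin.succEmb m)).piecewise (Fin.cons t x) w) :=
    hh.comp ((measurable_piecewise _).comp measurable_prodMk_left)
  have h4 : Integrable (fun z : S × (Fin m → S) => h ((J.map (Fin.succEmb m)).piecewise
      (Fin.cons t x) (Fin.cons z.1 z.2))) (ν.prod (Measure.pi fun _ => ν)) :=
    (measurePreserving_cons ν m).integrable_comp_of_integrable hx2
  rw [← (measurePreserving_cons ν m).map_eq,
    integral_map (measurable_cons m).aemeasurable hm.aestronglyMeasurable,
    integral_prod_symm _ h4]
  simp only [map_piecewise_cons]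
  rfl

end IncompleteUStat

/-! ### Induction on the number of arguments -/

namespace IncompleteUStat

open scoped ENNReal NNReal

variable {B : Type*} [NormedAddCommGroup B] [NormedSpace ℝ B] [CompleteSpace B]
  [MeasurableSpace B] [BorelSpace B] [SecondCountableTopology B]
  {p q : ℝ} {Φ : B → ℝ≥0∞} {c : ℝ≥0∞}

omit [NormedSpace ℝ B] [CompleteSpace B] in
lemma integrable_of_lintegral_enorm_rpow_ne_top {α : Type*} [MeasurableSpace α] {μ : Measure α}
    [IsProbabilityMeasure μ] (hq : 1 ≤ q) {f : α → B} (hf : Measurable f)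
    (h : ∫⁻ x, ‖f x‖ₑ ^ q ∂μ ≠ ∞) : Integrable f μ := by
  refine ⟨hf.aestronglyMeasurable, ?_⟩
  have h1 := rpow_lintegral_le_lintegral_rpow hf.enorm.aemeasurable (μ := μ) hq
  have hq0 : 0 < q := by linarith
  exact (ENNReal.rpow_lt_top_iff_of_pos hq0).1 (h1.trans_lt (lt_top_iff_ne_top.2 h))

omit [NormedSpace ℝ B] [CompleteSpace B] [SecondCountableTopology B] in
lemma lintegral_kernelSum_section₀_le {S : Type*} [MeasurableSpace S] {ν : Measure S}
    [IsProbabilityMeasure ν] {m k : ℕ} {h : (Fin (m + 1) → S) → B} (hh : Measurable h) {K : ℝ≥0∞}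
    (H : ∀ᵐ t ∂ν, ∫⁻ x, ‖kernelSum m k (section₀ h t) x‖ₑ ^ q ∂(Measure.pi fun _ => ν) ≤
      K * ∫⁻ y, ‖section₀ h t y‖ₑ ^ q ∂(Measure.pi fun _ => ν)) :
    ∫⁻ t, ∫⁻ x, ‖kernelSum m k (section₀ h t) x‖ₑ ^ q ∂(Measure.pi fun _ => ν) ∂ν ≤
      K * ∫⁻ y, ‖h y‖ₑ ^ q ∂(Measure.pi fun _ => ν) := by
  rw [lintegral_pi_succ' (hh.enorm.pow_const q)]
  have hm : Measurable fun t => ∫⁻ y, ‖h (Fin.cons t y)‖ₑ ^ q ∂(Measure.pi fun _ : Fin m => ν) :=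
    Measurable.lintegral_prod_right' (f := fun z : S × (Fin m → S) => ‖h (Fin.cons z.1 z.2)‖ₑ ^ q)
      ((hh.comp (measurable_cons m)).enorm.pow_const q)
  rw [← lintegral_const_mul _ hm]
  exact lintegral_mono_ae H

/-- Moment bound for the sums over increasing tuples of a kernel which is degenerate with respect
to fewer than `d` of its arguments. -/
theorem IsPotential.exists_lintegral_enorm_kernelSum_rpow_le (hΦ : IsPotential p q Φ c)
    (hp : 1 < p) (hpq : p ≤ q) (m d : ℕ) :
    ∃ K : ℝ≥0∞, K ≠ ∞ ∧ 1 ≤ K ∧ ∀ {S : Type*} [MeasurableSpace S] (ν : Measure S)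
      [IsProbabilityMeasure ν] (h : (Fin m → S) → B), Measurable h → DegenerateKernel ν d h →
      ∀ n N : ℕ, 1 ≤ N → n ≤ N →
        ∫⁻ x, ‖kernelSum m n h x‖ₑ ^ q ∂(Measure.pi fun _ => ν) ≤
          K * (N : ℝ≥0∞) ^ (q * ((m : ℝ) - d) + d * q / p) *
            ∫⁻ y, ‖h y‖ₑ ^ q ∂(Measure.pi fun _ => ν) := by
  have hp0 : 0 < p := by linarith
  have hq0 : 0 < q := by linarith
  have hq1 : 1 ≤ q := by linarith
  have hs0 : 0 < q / p := by positivity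
  induction m generalizing d with
  | zero =>
    refine ⟨1, by simp, le_rfl, fun {S} _ ν _ h hh hd n N hN hn => ?_⟩
    simp only [kernelSum_zero_left]
    cases d with
    | zero =>
      have : ∀ y, h y = h default := fun y => by rw [Subsingleton.elim y default]
      simp [this]
    -- Without arguments, degeneracy at `J = ∅` forces the constant `h` to vanish. This lets the
    -- induction run for every `d`, including `d > m`.
    | succ d =>
      obtain ⟨x, hx⟩ := (hd ∅ (by simp)).exists
      have h0 : h default = 0 := by
        rw [← hx]
        have : ∀ y, h ((∅ : Finset (Fin 0)).piecewise x y) = h default := fun y => by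
          congr 1; exact Subsingleton.elim _ _
        simp only [this]
        simp
      rw [h0]
      simp [ENNReal.zero_rpow_of_pos hq0]
  | succ m ih =>
    have hpow : ∀ (N : ℕ), 1 ≤ N → ∀ a b : ℝ,
        (N : ℝ≥0∞) ^ a * (N : ℝ≥0∞) ^ b = (N : ℝ≥0∞) ^ (a + b) := fun N hN a b =>
      (ENNReal.rpow_add a b (by exact_mod_cast (by omega : N ≠ 0)) (by simp)).symm
    cases d with
    | zero =>
      obtain ⟨K, hK, hK1, H⟩ := ih 0
      refine ⟨K, hK, hK1, fun {S} _ ν _ h hh hd n N hN hn => ?_⟩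
      have hsec : ∀ t, Measurable (section₀ h t) := fun t =>
        (measurable_uncurry_section₀ hh).comp measurable_prodMk_left
      calc _ ≤ _ := lintegral_enorm_kernelSum_succ_rpow_le hq1 hh fun k hk =>
            lintegral_kernelSum_section₀_le hh (ae_of_all _ fun t =>
              H ν (section₀ h t) (hsec t) (fun J hJ => absurd hJ (by simp)) k N hN (by omega))
        _ ≤ (N : ℝ≥0∞) ^ q * (K * (N : ℝ≥0∞) ^ (q * ((m : ℝ) - (0 : ℕ)) + (0 : ℕ) * q / p) *
              ∫⁻ y, ‖h y‖ₑ ^ q ∂(Measure.pi fun _ => ν)) := by gcongr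
        _ = K * ((N : ℝ≥0∞) ^ q * (N : ℝ≥0∞) ^ (q * ((m : ℝ) - (0 : ℕ)) + (0 : ℕ) * q / p)) *
              ∫⁻ y, ‖h y‖ₑ ^ q ∂(Measure.pi fun _ => ν) := by ring
        _ = _ := by
          rw [hpow N hN]
          congr 3
          push_cast
          ring
    | succ d =>
      -- `K₁` serves the mean, which keeps order `d + 1`; `K₂` serves the sections, of order `d`.
      obtain ⟨K₁, hK₁, hK₁1, H₁⟩ := ih (d + 1)
      obtain ⟨K₂, hK₂, hK₂1, H₂⟩ := ih d
      set M : ℝ≥0∞ := c * ((2 * (c * c)) ^ (q / p) + 2 * (c * c)) * 2 ^ q with hM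
      have h2c : 2 * (c * c) ≠ ∞ :=
        ENNReal.mul_ne_top (by simp) (ENNReal.mul_ne_top hΦ.ne_top hΦ.ne_top)
      have hMtop : M ≠ ∞ := by
        refine ENNReal.mul_ne_top (ENNReal.mul_ne_top hΦ.ne_top (ENNReal.add_ne_top.2 ⟨?_, h2c⟩))
          (ENNReal.rpow_ne_top_of_nonneg hq0.le (by simp))
        exact ENNReal.rpow_ne_top_of_nonneg hs0.le h2c
      have h2 : (2 : ℝ≥0∞) ^ (q - 1) ≠ ∞ :=
        ENNReal.rpow_ne_top_of_nonneg (by linarith) (by simp)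
      have h21 : (1 : ℝ≥0∞) ≤ 2 ^ (q - 1) := by
        rw [← ENNReal.rpow_zero (x := 2)]
        exact ENNReal.rpow_le_rpow_of_exponent_le (by norm_num) (by linarith)
      have hK1 : 1 ≤ 2 ^ (q - 1) * (M * K₂ + K₁) :=
        one_le_mul h21 (hK₁1.trans le_add_self)
      refine ⟨2 ^ (q - 1) * (M * K₂ + K₁), ENNReal.mul_ne_top h2
        (ENNReal.add_ne_top.2 ⟨ENNReal.mul_ne_top hMtop hK₂, hK₁⟩), hK1,
        fun {S} _ ν _ h hh hd n N hN hn => ?_⟩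
      set L := ∫⁻ y, ‖h y‖ₑ ^ q ∂(Measure.pi fun _ => ν) with hL
      have hN0 : (N : ℝ≥0∞) ≠ 0 := by exact_mod_cast (by omega : N ≠ 0)
      -- An infinite moment makes the right side infinite, as its factor is nonzero by `1 ≤ K` and
      -- `1 ≤ N`; a finite one makes `h` integrable.
      by_cases hLtop : L = ∞
      · have hne : 2 ^ (q - 1) * (M * K₂ + K₁) *
            (N : ℝ≥0∞) ^ (q * (((m + 1 : ℕ) : ℝ) - ((d + 1 : ℕ) : ℝ)) +
              ((d + 1 : ℕ) : ℝ) * q / p) ≠ 0 :=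
          mul_ne_zero (zero_lt_one.trans_le hK1).ne'
            (ENNReal.rpow_pos (pos_iff_ne_zero.2 hN0) (by simp)).ne'
        rw [hLtop, ENNReal.mul_top hne]
        exact le_top
      have hint : Integrable h (Measure.pi fun _ => ν) :=
        integrable_of_lintegral_enorm_rpow_ne_top hq1 hh hLtop
      have hsec : ∀ t, Measurable (section₀ h t) := fun t =>
        (measurable_uncurry_section₀ hh).comp measurable_prodMk_left
      have hmm : Measurable (mean₀ ν h) := measurable_mean₀ hh
      set g : (Fin (m + 1) → S) → B := fun y => h y - mean₀ ν h (Fin.tail y) with hg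
      set g' : (Fin (m + 1) → S) → B := fun y => mean₀ ν h (Fin.tail y) with hg'
      have hg'm : Measurable g' := hmm.comp (measurable_tail m)
      have hgm : Measurable g := hh.sub hg'm
      have b1 : ∫⁻ x, ‖kernelSum (m + 1) n g x‖ₑ ^ q ∂(Measure.pi fun _ => ν) ≤
          M * ((N : ℝ≥0∞) ^ (q / p) * (K₂ * (N : ℝ≥0∞) ^ (q * ((m : ℝ) - d) + d * q / p) * L)) := by
        refine (hΦ.lintegral_enorm_kernelSum_sub_mean₀_rpow_le hp hpq hh hint (A := K₂ *
          (N : ℝ≥0∞) ^ (q * ((m : ℝ) - d) + d * q / p) * L) fun k hk =>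
          lintegral_kernelSum_section₀_le hh ?_).trans (by gcongr)
        filter_upwards [hd.ae_section₀ hh] with t ht
        exact H₂ ν _ (hsec t) ht k N hN (by omega)
      have b2 : ∫⁻ x, ‖kernelSum (m + 1) n g' x‖ₑ ^ q ∂(Measure.pi fun _ => ν) ≤
          (N : ℝ≥0∞) ^ q *
            (K₁ * (N : ℝ≥0∞) ^ (q * ((m : ℝ) - (d + 1 : ℕ)) + (d + 1 : ℕ) * q / p) * L) := by
        refine (lintegral_enorm_kernelSum_succ_rpow_le hq1 hg'm (A := K₁ * (N : ℝ≥0∞) ^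
          (q * ((m : ℝ) - (d + 1 : ℕ)) + (d + 1 : ℕ) * q / p) * L) fun k hk => ?_).trans
          (by gcongr)
        have e : ∀ t, section₀ g' t = mean₀ ν h := fun t => by
          funext y
          simp [section₀, hg']
        simp only [e, lintegral_const, measure_univ, mul_one]
        calc _ ≤ _ := H₁ ν _ hmm (hd.mean₀ hh hint) k N hN (by omega)
          _ ≤ _ := by
            gcongr
            exact lintegral_enorm_mean₀_rpow_le hq1 hh
      have hk1 : Measurable fun x : Fin n → S => ‖kernelSum (m + 1) n g x‖ₑ ^ q :=
        (measurable_kernelSum hgm).enorm.pow_const q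
      have hk2 : Measurable fun x : Fin n → S => ‖kernelSum (m + 1) n g' x‖ₑ ^ q :=
        (measurable_kernelSum hg'm).enorm.pow_const q
      calc _ ≤ ∫⁻ x, 2 ^ (q - 1) * (‖kernelSum (m + 1) n g x‖ₑ ^ q +
              ‖kernelSum (m + 1) n g' x‖ₑ ^ q) ∂(Measure.pi fun _ => ν) := by
            refine lintegral_mono fun x => ?_
            have : kernelSum (m + 1) n h x =
                kernelSum (m + 1) n g x + kernelSum (m + 1) n g' x := by
              rw [hg, kernelSum_sub, sub_add_cancel]
            rw [this]
            exact enorm_add_rpow_le hq1 _ _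
        _ = 2 ^ (q - 1) * (∫⁻ x, ‖kernelSum (m + 1) n g x‖ₑ ^ q ∂(Measure.pi fun _ => ν) +
              ∫⁻ x, ‖kernelSum (m + 1) n g' x‖ₑ ^ q ∂(Measure.pi fun _ => ν)) := by
            rw [lintegral_const_mul _ (by fun_prop), lintegral_add_left hk1]
        _ ≤ 2 ^ (q - 1) * (M * ((N : ℝ≥0∞) ^ (q / p) *
              (K₂ * (N : ℝ≥0∞) ^ (q * ((m : ℝ) - d) + d * q / p) * L)) + (N : ℝ≥0∞) ^ q *
              (K₁ * (N : ℝ≥0∞) ^ (q * ((m : ℝ) - (d + 1 : ℕ)) + (d + 1 : ℕ) * q / p) * L)) := by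
            gcongr
        _ = 2 ^ (q - 1) * (M * K₂ * ((N : ℝ≥0∞) ^ (q / p) *
              (N : ℝ≥0∞) ^ (q * ((m : ℝ) - d) + d * q / p)) + K₁ * ((N : ℝ≥0∞) ^ q *
              (N : ℝ≥0∞) ^ (q * ((m : ℝ) - (d + 1 : ℕ)) + (d + 1 : ℕ) * q / p))) * L := by ring
        _ = _ := by
            rw [hpow N hN, hpow N hN]
            have e1 : q / p + (q * ((m : ℝ) - d) + d * q / p) =
                q * (((m + 1 : ℕ) : ℝ) - ((d + 1 : ℕ) : ℝ)) + ((d + 1 : ℕ) : ℝ) * q / p := by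
              push_cast; ring
            have e2 : q + (q * ((m : ℝ) - (d + 1 : ℕ)) + (d + 1 : ℕ) * q / p) =
                q * (((m + 1 : ℕ) : ℝ) - ((d + 1 : ℕ) : ℝ)) + ((d + 1 : ℕ) : ℝ) * q / p := by
              push_cast; ring
            rw [e1, e2]
            ring

end IncompleteUStat

/-! ### From the i.i.d. sequence to the product measure -/

namespace IncompleteUStat

open scoped ENNReal NNReal

variable {Ω S : Type*} [MeasurableSpace Ω] [MeasurableSpace S] {μ : Measure Ω}
  [IsProbabilityMeasure μ] {ξ : ℤ → Ω → S}

lemma IsIID.map_eq_pi (hξ : IsIID μ ξ) {κ : Type*} [Fintype κ] {g : κ → ℤ}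
    (hg : Function.Injective g) :
    μ.map (fun ω k => ξ (g k) ω) = Measure.pi fun _ => μ.map (ξ 1) := by
  rw [(iIndepFun_iff_map_fun_eq_pi_map fun k => (hξ.1 (g k)).aemeasurable).1
    (hξ.2.1.precomp hg)]
  congr 1
  funext k
  exact (hξ.2.2 (g k) 1).map_eq

lemma IsIID.isProbabilityMeasure_map (hξ : IsIID μ ξ) : IsProbabilityMeasure (μ.map (ξ 1)) :=
  Measure.isProbabilityMeasure_map (hξ.1 1).aemeasurable

lemma exists_perm_forall_mem_lt {m d : ℕ} (hd : d ≤ m) (J : Finset (Fin m)) (hJ : J.card ≤ d) :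
    ∃ σ : Equiv.Perm (Fin m), ∀ k ∈ J, (σ k : ℕ) < d := by
  obtain ⟨J', hJ', hcard⟩ := Finset.exists_subset_card_eq
    (s := Finset.univ.map (Fin.castLEEmb hd)) (n := J.card) (by simpa using hJ)
  refine ⟨(Finset.equivOfCardEq hcard.symm).extendSubtype, fun k hk => ?_⟩
  have h1 := hJ' (Equiv.extendSubtype_mem (Finset.equivOfCardEq hcard.symm) k hk)
  obtain ⟨i, -, hi⟩ := Finset.mem_map.1 h1
  rw [← hi]
  simp

variable {B : Type*} [NormedAddCommGroup B] [NormedSpace ℝ B] [CompleteSpace B]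
  [MeasurableSpace B] [BorelSpace B] [SecondCountableTopology B]

/-- Symmetry allows the arguments in `J`, at most `d - 1` of them, to be moved among the first `d -
1` places. The partial integral of `h` over the other arguments then has zero integral over every
measurable set, by the defining property of the conditional expectation, and so vanishes almost
everywhere. -/
lemma IsIID.degenerateKernel (hξ : IsIID μ ξ) {m d : ℕ} (hd1 : 1 ≤ d) (hdm : d ≤ m)
    {h : (Fin m → S) → B} (hh : Measurable h) (hsymm : IsSymmKernel h)
    (hdeg : IsDegenerateOfOrder μ ξ h d) : DegenerateKernel (μ.map (ξ 1)) d h := by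
  have := hξ.isProbabilityMeasure_map
  set ν := μ.map (ξ 1) with hν
  obtain ⟨hint, hcond, -⟩ := hdeg
  intro J hJ
  let : Fintype {k // k ∈ J} := Subtype.fintype _
  obtain ⟨σ, hσ⟩ := exists_perm_forall_mem_lt (by omega : d - 1 ≤ m) J (by omega)
  set φ : Ω → Fin m → S := fun ω k => ξ ((σ k : ℕ) + 1) ω with hφ
  have hφinj : Function.Injective fun k : Fin m => (((σ k : ℕ) : ℤ) + 1) := fun k l hkl => by
    have : (σ k : ℕ) = (σ l : ℕ) := by simpa using hkl
    exact σ.injective (Fin.ext this)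
  have hφm : Measurable φ := measurable_pi_lambda _ fun k => hξ.1 _
  have hφlaw : μ.map φ = Measure.pi fun _ => ν := hξ.map_eq_pi hφinj
  have hhφ : ∀ ω, h (φ ω) = h (firstVec ξ m ω) := fun ω => hsymm σ (firstVec ξ m ω)
  have hintpi : Integrable h (Measure.pi fun _ => ν) := by
    rw [← hφlaw, integrable_map_measure hh.aestronglyMeasurable hφm.aemeasurable]
    exact hint.congr (ae_of_all _ fun ω => (hhφ ω).symm)
  set E := MeasurableEquiv.piEquivPiSubtypeProd (fun _ : Fin m => S) (· ∈ J) with hE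
  have hEMP := measurePreserving_piEquivPiSubtypeProd (fun _ : Fin m => ν) (· ∈ J)
  have hintE : Integrable (fun z => h (E.symm z))
      ((Measure.pi fun _ => ν).prod (Measure.pi fun _ => ν)) :=
    hEMP.symm.integrable_comp_of_integrable hintpi
  have hG : (fun a => ∫ b, h (E.symm (a, b)) ∂(Measure.pi fun _ => ν))
      =ᵐ[Measure.pi fun _ => ν] 0 := by
    refine hintE.integral_prod_left.ae_eq_zero_of_forall_setIntegral_eq_zero fun A hA _ => ?_
    have e1 : ∫ a in A, ∫ b, h (E.symm (a, b)) ∂(Measure.pi fun _ => ν) ∂(Measure.pi fun _ => ν) =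
        ∫ x in E ⁻¹' (A ×ˢ Set.univ), h x ∂(Measure.pi fun _ => ν) := by
      have e2 := hEMP.setIntegral_preimage_emb E.measurableEmbedding (h ∘ E.symm)
        (A ×ˢ Set.univ)
      simp only [Function.comp_apply, ← hE, E.symm_apply_apply] at e2
      rw [e2, setIntegral_prod (fun z => h (E.symm z)) hintE.integrableOn]
      simp only [Measure.restrict_univ]
    have hAm : MeasurableSet (E ⁻¹' (A ×ˢ Set.univ)) := E.measurable (hA.prod MeasurableSet.univ)
    have e3 : ∫ x in E ⁻¹' (A ×ˢ Set.univ), h x ∂(Measure.pi fun _ => ν) =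
        ∫ ω in φ ⁻¹' (E ⁻¹' (A ×ˢ Set.univ)), h (firstVec ξ m ω) ∂μ := by
      rw [← hφlaw, setIntegral_map hAm hh.aestronglyMeasurable hφm.aemeasurable]
      simp only [hhφ]
    have hfm : Measurable (firstVec ξ (d - 1)) := measurable_pi_lambda _ fun k => hξ.1 _
    -- The event constrains only the coordinates in `J` of the permuted vector, and these are among
    -- `ξ_1, …, ξ_{d-1}` by the choice of `σ`.
    have hs : MeasurableSet[firstSigma ξ (d - 1)] (φ ⁻¹' (E ⁻¹' (A ×ˢ Set.univ))) := by
      refine ⟨(fun (v : Fin (d - 1) → S) (j : {k // k ∈ J}) => v ⟨σ j, hσ j j.2⟩) ⁻¹' A,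
        (measurable_pi_lambda _ fun j => measurable_pi_apply _) hA, ?_⟩
      ext ω
      simp [hE, MeasurableEquiv.piEquivPiSubtypeProd, Equiv.piEquivPiSubtypeProd, firstVec, hφ]
    have e4 := setIntegral_condExp (μ := μ) hfm.comap_le hint hs
    refine (e1.trans (e3.trans e4.symm)).trans ?_
    rw [setIntegral_congr_ae (g := fun _ => (0 : B)) (hfm.comap_le _ hs)
      (by filter_upwards [hcond] with ω hω _ using hω)]
    simp
  have h1 : ∀ᵐ x ∂(Measure.pi fun _ : Fin m => ν),
      ∫ b, h (E.symm ((E x).1, b)) ∂(Measure.pi fun _ => ν) = 0 :=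
    (measurePreserving_fst.comp hEMP).quasiMeasurePreserving.ae hG
  filter_upwards [h1] with x hx
  simp only [piecewise_eq_piEquivPiSubtypeProd_symm, ← hE]
  rw [← hx]
  have hm : Measurable fun b => h (E.symm ((E x).1, b)) :=
    hh.comp (E.symm.measurable.comp measurable_prodMk_left)
  have hsnd := measurePreserving_snd.comp hEMP
  have := integral_map (μ := Measure.pi fun _ : Fin m => ν) hsnd.measurable.aemeasurable
    hm.aestronglyMeasurable
  rw [hsnd.map_eq] at this
  exact this.symm

end IncompleteUStat

/-! ### Increasing tuples of integers and Bernoulli moments -/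

namespace IncompleteUStat

open scoped ENNReal NNReal

lemma card_Inc_le (m n : ℕ) : (Inc m n).card ≤ n ^ m := by
  refine (Finset.card_filter_le _ _).trans ?_
  simp

lemma one_le_of_mem_Inc {m n : ℕ} (i : Inc m n) (k : Fin m) : 1 ≤ i.1 k :=
  (Finset.mem_Icc.1 (Fintype.mem_piFinset.1 (Finset.mem_filter.1 i.2).1 k)).1

lemma injective_of_mem_Inc {m n : ℕ} (i : Inc m n) : Function.Injective i.1 :=
  StrictMono.injective fun j k hjk => (Finset.mem_filter.1 i.2).2 j k hjk

/-- Sums over `Inc m n` are sums over strictly increasing maps `Fin m → Fin n`. -/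
lemma sum_Inc_eq_kernelSum {Ω S B : Type*} [NormedAddCommGroup B] (m n : ℕ) (ξ : ℤ → Ω → S)
    (h : (Fin m → S) → B) (ω : Ω) :
    ∑ i : Inc m n, h (fun k => ξ (i.1 k) ω) = kernelSum m n h (firstVec ξ n ω) := by
  classical
  rw [Finset.sum_coe_sort (Inc m n) fun i => h fun k => ξ (i k) ω, kernelSum]
  symm
  -- The shift by one matches indices in `Fin n`, which start at `0`, with the integers `1, …, n`.
  refine Finset.sum_bij (fun f _ k => ((f k : ℕ) : ℤ) + 1) ?_ ?_ ?_ ?_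
  · intro f hf
    have hf := (Finset.mem_filter.1 hf).2
    refine Finset.mem_filter.2 ⟨Fintype.mem_piFinset.2 fun k => Finset.mem_Icc.2 ?_, ?_⟩
    · have := (f k).2
      omega
    · intro j k hjk
      have : (f j : ℕ) < f k := hf hjk
      simpa using this
  · intro f _ g _ hfg
    funext k
    have := congrFun hfg k
    exact Fin.ext (by simpa using this)
  · intro i hi
    have h1 : ∀ k, 1 ≤ i k ∧ i k ≤ n := fun k =>
      Finset.mem_Icc.1 (Fintype.mem_piFinset.1 (Finset.mem_filter.1 hi).1 k)
    refine ⟨fun k => ⟨(i k - 1).toNat, by have := h1 k; omega⟩, ?_, ?_⟩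
    · refine Finset.mem_filter.2 ⟨Finset.mem_univ _, fun j k hjk => ?_⟩
      have := (Finset.mem_filter.1 hi).2 j k hjk
      have := h1 j
      have := h1 k
      rw [Fin.lt_def]
      simp only
      omega
    · funext k
      have := h1 k
      simp only
      omega
  · intro f _
    rfl

section Bernoulli

variable {Ω : Type*} [MeasurableSpace Ω] {μ : Measure Ω}
  {pn : unitInterval} {b : Ω → ℝ}

lemma lintegral_comp_bernoulli (hb : HasLaw b (bernoulliMeasure (1 : ℝ) 0 pn) μ) {f : ℝ → ℝ≥0∞}
    (hf : Measurable f) :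
    ∫⁻ ω, f (b ω) ∂μ = ENNReal.ofReal pn * f 1 + ENNReal.ofReal (1 - pn) * f 0 := by
  rw [hb.lintegral_comp hf.aemeasurable, bernoulliMeasure_def, lintegral_add_measure]
  simp only [lintegral_smul_measure, lintegral_dirac' _ hf, ENNReal.smul_def, smul_eq_mul]
  have e : ∀ x : unitInterval, ((unitInterval.toNNReal x : ℝ≥0) : ℝ≥0∞) = ENNReal.ofReal x :=
    fun x => by
      rw [ENNReal.ofReal]
      congr 1
      ext
      simp [x.2.1]
  rw [e, e]
  simp

/-- The two atoms contribute `p_n (1 - p_n) ^ t` and `(1 - p_n) p_n ^ t`, each at most `p_n` since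
`t ≥ 1`. The bound is linear in `p_n` for every `t`, in particular for both `p` and `q`. -/
lemma lintegral_enorm_bernoulli_sub_rpow_le (hb : HasLaw b (bernoulliMeasure (1 : ℝ) 0 pn) μ)
    {t : ℝ} (ht : 1 ≤ t) :
    ∫⁻ ω, ‖b ω - pn‖ₑ ^ t ∂μ ≤ 2 * ENNReal.ofReal pn := by
  have h0 := pn.2.1
  have h1 := pn.2.2
  rw [lintegral_comp_bernoulli hb (f := fun x => ‖x - pn‖ₑ ^ t) (by fun_prop), two_mul]
  have e1 : ‖(1 : ℝ) - pn‖ₑ ≤ 1 := by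
    rw [← ofReal_norm, Real.norm_of_nonneg (by linarith), ← ENNReal.ofReal_one]
    exact ENNReal.ofReal_le_ofReal (by linarith)
  have e2 : ‖(0 : ℝ) - pn‖ₑ = ENNReal.ofReal pn := by
    rw [zero_sub, enorm_neg, ← ofReal_norm, Real.norm_of_nonneg h0]
  have e3 : ENNReal.ofReal pn ≤ 1 := by
    rw [← ENNReal.ofReal_one]; exact ENNReal.ofReal_le_ofReal h1
  have e4 : ENNReal.ofReal (1 - pn) ≤ 1 := by
    rw [← ENNReal.ofReal_one]; exact ENNReal.ofReal_le_ofReal (by linarith)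
  rw [e2]
  refine add_le_add (mul_le_of_le_one_right zero_le (ENNReal.rpow_le_one e1 (by linarith))) ?_
  calc _ ≤ 1 * ENNReal.ofReal pn ^ (1 : ℝ) :=
        mul_le_mul' e4 (ENNReal.rpow_le_rpow_of_exponent_ge e3 ht)
    _ = _ := by simp

lemma integrable_bernoulli (hb : HasLaw b (bernoulliMeasure (1 : ℝ) 0 pn) μ) : Integrable b μ := by
  refine ⟨hb.aemeasurable.aestronglyMeasurable, ?_⟩
  have := lintegral_comp_bernoulli hb (f := fun x => ‖x‖ₑ) (by fun_prop)
  rw [HasFiniteIntegral, this]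
  simp

lemma integral_bernoulli (hb : HasLaw b (bernoulliMeasure (1 : ℝ) 0 pn) μ) :
    ∫ ω, b ω ∂μ = pn := by
  have := hb.integral_comp (f := id) aestronglyMeasurable_id
  simp only [Function.comp_def, id] at this
  rw [this]
  simpa using ProbabilityTheory.integral_bernoulliMeasure (1 : ℝ) 0 pn id

end Bernoulli

end IncompleteUStat

/-! ### Splitting off the centered weights -/

namespace IncompleteUStat

open scoped ENNReal NNReal

lemma incompleteUStat_eq {Ω S B : Type*} [NormedAddCommGroup B] [NormedSpace ℝ B] {m n : ℕ}
    (a : Inc m n → Ω → ℝ) (ξ : ℤ → Ω → S) (h : (Fin m → S) → B)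
    (r : ℝ) (ω : Ω) :
    incompleteUStat a ξ h ω = r • kernelSum m n h (firstVec ξ n ω) +
      ∑ i : Inc m n, (a i ω - r) • h (fun k => ξ (i.1 k) ω) := by
  rw [← sum_Inc_eq_kernelSum, incompleteUStat, Finset.smul_sum, ← Finset.sum_add_distrib]
  refine Finset.sum_congr rfl fun i _ => ?_
  rw [← add_smul]
  congr 1
  ring

variable {B : Type*} [NormedAddCommGroup B] [NormedSpace ℝ B] [CompleteSpace B]
  [MeasurableSpace B] [BorelSpace B] [SecondCountableTopology B]
  {p q : ℝ} {Φ : B → ℝ≥0∞} {c : ℝ≥0∞}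
  {Ω : Type*} [MeasurableSpace Ω] {μ : Measure Ω} [IsProbabilityMeasure μ] {pn : unitInterval}

/-- Moment bound for weighted sums of fixed vectors with independent centered Bernoulli weights. -/
lemma IsPotential.lintegral_enorm_sum_bernoulli_smul_le (hΦ : IsPotential p q Φ c) (hp : 1 < p)
    (hpq : p ≤ q) {ι : Type*} [Fintype ι] {a : ι → Ω → ℝ}
    (ha : ∀ i, HasLaw (a i) (bernoulliMeasure (1 : ℝ) 0 pn) μ) (hind : iIndepFun a μ) (x : ι → B) :
    ∫⁻ ω, ‖∑ i, (a i ω - pn) • x i‖ₑ ^ q ∂μ ≤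
      c * ((4 * (c * c)) ^ (q / p) * ENNReal.ofReal pn ^ (q / p) *
          (Fintype.card ι : ℝ≥0∞) ^ (q / p - 1) + 4 * (c * c) * ENNReal.ofReal pn) *
        ∑ i, ‖x i‖ₑ ^ q := by
  have hp0 : 0 < p := by linarith
  have hs : 1 ≤ q / p := (one_le_div hp0).2 hpq
  have hs0 : 0 ≤ q / p := by linarith
  have hY : iIndepFun (fun i ω => (a i ω - pn) • x i) μ :=
    hind.comp (fun i (r : ℝ) => (r - pn) • x i) fun i => by fun_prop
  have hint : ∀ i, Integrable (fun ω => (a i ω - pn) • x i) μ := fun i =>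
    ((integrable_bernoulli (ha i)).sub (integrable_const _)).smul_const _
  have hmean : ∀ i, ∫ ω, (a i ω - pn) • x i ∂μ = 0 := fun i => by
    rw [integral_smul_const, integral_sub (integrable_bernoulli (ha i)) (integrable_const _),
      integral_bernoulli (ha i)]
    simp
  have hmom : ∀ t : ℝ, 1 ≤ t → ∀ i, ∫⁻ ω, ‖(a i ω - pn) • x i‖ₑ ^ t ∂μ ≤
      2 * ENNReal.ofReal pn * ‖x i‖ₑ ^ t := fun t ht i => by
    have hm : AEMeasurable (fun ω => ‖a i ω - pn‖ₑ ^ t) μ :=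
      ((ha i).aemeasurable.sub_const _).enorm.pow_const t
    simp only [enorm_smul, ENNReal.mul_rpow_of_nonneg _ _ (by linarith : 0 ≤ t)]
    rw [lintegral_mul_const'' _ hm]
    gcongr
    exact lintegral_enorm_bernoulli_sub_rpow_le (ha i) ht
  -- The power mean inequality trades the sum of `p`-th powers for `q`-th powers, at the cost of a
  -- power of the number of terms.
  have hpow : (∑ i, ‖x i‖ₑ ^ p) ^ (q / p) ≤
      (Fintype.card ι : ℝ≥0∞) ^ (q / p - 1) * ∑ i, ‖x i‖ₑ ^ q := by
    have := ENNReal.rpow_sum_le_const_mul_sum_rpow Finset.univ (fun i => ‖x i‖ₑ ^ p) hs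
    simp only [← ENNReal.rpow_mul, mul_div_cancel₀ q hp0.ne'] at this
    simpa using this
  calc _ ≤ _ := hΦ.lintegral_enorm_sum_rpow_le hp hpq hY hint hmean Finset.univ
    _ ≤ c * ((2 * (c * c) * ∑ i, 2 * ENNReal.ofReal pn * ‖x i‖ₑ ^ p) ^ (q / p)
        + 2 * (c * c) * ∑ i, 2 * ENNReal.ofReal pn * ‖x i‖ₑ ^ q) := by
      gcongr with i _ i _
      · exact hmom p hp.le i
      · exact hmom q (hp.le.trans hpq) i
    _ = c * ((4 * (c * c) * ENNReal.ofReal pn * ∑ i, ‖x i‖ₑ ^ p) ^ (q / p)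
        + 4 * (c * c) * ENNReal.ofReal pn * ∑ i, ‖x i‖ₑ ^ q) := by
      simp only [← Finset.mul_sum]
      rw [show 2 * (c * c) * (2 * ENNReal.ofReal pn * ∑ i, ‖x i‖ₑ ^ p) =
          4 * (c * c) * ENNReal.ofReal pn * ∑ i, ‖x i‖ₑ ^ p by ring]
      ring
    _ = c * ((4 * (c * c)) ^ (q / p) * ENNReal.ofReal pn ^ (q / p) * (∑ i, ‖x i‖ₑ ^ p) ^ (q / p)
        + 4 * (c * c) * ENNReal.ofReal pn * ∑ i, ‖x i‖ₑ ^ q) := by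
      rw [ENNReal.mul_rpow_of_nonneg (4 * (c * c) * ENNReal.ofReal pn) _ hs0,
        ENNReal.mul_rpow_of_nonneg (4 * (c * c)) _ hs0]
    _ ≤ c * ((4 * (c * c)) ^ (q / p) * ENNReal.ofReal pn ^ (q / p) *
          ((Fintype.card ι : ℝ≥0∞) ^ (q / p - 1) * ∑ i, ‖x i‖ₑ ^ q)
        + 4 * (c * c) * ENNReal.ofReal pn * ∑ i, ‖x i‖ₑ ^ q) := by gcongr
    _ = _ := by ring

variable {S : Type*} [MeasurableSpace S] {ξ : ℤ → Ω → S} {m n : ℕ} {h : (Fin m → S) → B}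
  {a : Inc m n → Ω → ℝ}

omit [CompleteSpace B] [SecondCountableTopology B] [NormedSpace ℝ B] in
lemma IsIID.lintegral_enorm_comp_rpow (hξ : IsIID μ ξ) (hh : Measurable h) {g : Fin m → ℤ}
    (hg : Function.Injective g) :
    ∫⁻ ω, ‖h (fun k => ξ (g k) ω)‖ₑ ^ q ∂μ =
      ∫⁻ y, ‖h y‖ₑ ^ q ∂(Measure.pi fun _ => μ.map (ξ 1)) := by
  rw [← hξ.map_eq_pi hg, lintegral_map (hh.enorm.pow_const q)
    (measurable_pi_lambda _ fun k => hξ.1 (g k))]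

lemma injective_firstVec_index (n : ℕ) : Function.Injective fun k : Fin n => ((k : ℕ) : ℤ) + 1 :=
  fun k l hkl => Fin.ext (by simpa using hkl)

/-- Moment bound for the part of the incomplete `U`-statistic with centered weights. -/
lemma IsPotential.lintegral_enorm_centered_part_le (hΦ : IsPotential p q Φ c) (hp : 1 < p)
    (hpq : p ≤ q) (hξ : IsIID μ ξ) (hh : Measurable h) (hn : 1 ≤ n)
    (ha : ∀ i, HasLaw (a i) (bernoulliMeasure (1 : ℝ) 0 pn) μ) (hind : iIndepFun a μ)
    (hindξ : IndepFun (fun ω i => a i ω) (fun ω (j : {j : ℤ // 1 ≤ j}) => ξ j ω) μ) :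
    ∫⁻ ω, ‖∑ i : Inc m n, (a i ω - pn) • h (fun k => ξ (i.1 k) ω)‖ₑ ^ q ∂μ ≤
      c * ((4 * (c * c)) ^ (q / p) * (ENNReal.ofReal pn ^ (q / p) * (n : ℝ≥0∞) ^ (m * q / p)) +
          4 * (c * c) * (ENNReal.ofReal pn * (n : ℝ≥0∞) ^ m)) *
        ∫⁻ ω, ‖h (firstVec ξ m ω)‖ₑ ^ q ∂μ := by
  have hp0 : 0 < p := by linarith
  have hs : 1 ≤ q / p := (one_le_div hp0).2 hpq
  set X : Ω → {j : ℤ // 1 ≤ j} → S := fun ω j => ξ j ω with hX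
  have hXm : Measurable X := measurable_pi_lambda _ fun j => hξ.1 j
  have ham : AEMeasurable (fun ω i => a i ω) μ := aemeasurable_pi_lambda _ fun i =>
    (ha i).aemeasurable
  -- All indices in `Inc m n` are positive, so only the variables `ξ_j` with `j ≥ 1`, which are
  -- independent of the weights, occur.
  set κ : Inc m n → Fin m → {j : ℤ // 1 ≤ j} := fun i k => ⟨i.1 k, one_le_of_mem_Inc i k⟩ with hκ
  set F : (Inc m n → ℝ) × ({j : ℤ // 1 ≤ j} → S) → ℝ≥0∞ :=
    fun z => ‖∑ i, (z.1 i - pn) • h (fun k => z.2 (κ i k))‖ₑ ^ q with hF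
  have hhκ : ∀ i, Measurable fun z : (Inc m n → ℝ) × ({j : ℤ // 1 ≤ j} → S) =>
      h (fun k => z.2 (κ i k)) := fun i => hh.comp (measurable_pi_lambda _ fun k =>
    (measurable_pi_apply _).comp measurable_snd)
  have hFm : Measurable F := by
    refine (Finset.measurable_fun_sum _ fun i _ => ?_).enorm.pow_const q
    exact (((measurable_pi_apply i).comp measurable_fst).sub_const _).smul (hhκ i)
  have hlaw := hindξ.map_prod_eq_prod_map_map ham hXm.aemeasurable
  have := Measure.isProbabilityMeasure_map (μ := μ) ham
  have := Measure.isProbabilityMeasure_map (μ := μ) hXm.aemeasurable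
  -- Independence allows the weights to be averaged first, with the `ξ_j` frozen at `ω'`.
  have e1 : ∫⁻ ω, ‖∑ i : Inc m n, (a i ω - pn) • h (fun k => ξ (i.1 k) ω)‖ₑ ^ q ∂μ =
      ∫⁻ ω', ∫⁻ ω, ‖∑ i : Inc m n, (a i ω - pn) • h (fun k => ξ (i.1 k) ω')‖ₑ ^ q ∂μ ∂μ := by
    have e2 := lintegral_map' (μ := μ) (g := fun ω => ((fun i => a i ω), X ω))
      hFm.aemeasurable (ham.prodMk hXm.aemeasurable)
    refine e2.symm.trans ?_
    rw [hlaw, lintegral_prod_symm _ hFm.aemeasurable, lintegral_map hFm.lintegral_prod_left' hXm]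
    refine lintegral_congr fun ω' => ?_
    have hFω : Measurable fun z => F (z, X ω') := hFm.comp measurable_prodMk_right
    rw [lintegral_map' hFω.aemeasurable ham]
  set R : ℝ≥0∞ := c * ((4 * (c * c)) ^ (q / p) * ENNReal.ofReal pn ^ (q / p) *
    (Fintype.card (Inc m n) : ℝ≥0∞) ^ (q / p - 1) + 4 * (c * c) * ENNReal.ofReal pn) with hR
  set L := ∫⁻ ω, ‖h (firstVec ξ m ω)‖ₑ ^ q ∂μ with hL
  have hmom : ∀ i : Inc m n, ∫⁻ ω, ‖h (fun k => ξ (i.1 k) ω)‖ₑ ^ q ∂μ = L := fun i => by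
    rw [hξ.lintegral_enorm_comp_rpow hh (injective_of_mem_Inc i), hL]
    exact (hξ.lintegral_enorm_comp_rpow hh (injective_firstVec_index m)).symm
  have hmeas : ∀ i : Inc m n, Measurable fun ω => ‖h (fun k => ξ (i.1 k) ω)‖ₑ ^ q := fun i =>
    (hh.comp (measurable_pi_lambda _ fun k => hξ.1 (i.1 k))).enorm.pow_const q
  have hcard : (Fintype.card (Inc m n) : ℝ≥0∞) ≤ (n : ℝ≥0∞) ^ m := by
    rw [Fintype.card_coe]
    exact_mod_cast card_Inc_le m n
  have hcard2 : (Fintype.card (Inc m n) : ℝ≥0∞) ^ (q / p - 1) * (Fintype.card (Inc m n) : ℝ≥0∞) ≤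
      (n : ℝ≥0∞) ^ (m * q / p) := by
    have hn0 : (n : ℝ≥0∞) ≠ 0 := by exact_mod_cast (by omega : n ≠ 0)
    calc _ ≤ ((n : ℝ≥0∞) ^ m) ^ (q / p - 1) * (n : ℝ≥0∞) ^ m :=
          mul_le_mul' (ENNReal.rpow_le_rpow hcard (by linarith)) hcard
      _ = (n : ℝ≥0∞) ^ ((m : ℝ) * (q / p - 1)) * (n : ℝ≥0∞) ^ (m : ℝ) := by
          rw [ENNReal.rpow_mul, ENNReal.rpow_natCast]
      _ = _ := by
          rw [← ENNReal.rpow_add _ _ hn0 (by simp)]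
          congr 1
          ring
  calc _ = _ := e1
    _ ≤ ∫⁻ ω', R * ∑ i : Inc m n, ‖h (fun k => ξ (i.1 k) ω')‖ₑ ^ q ∂μ :=
        lintegral_mono fun ω' => hΦ.lintegral_enorm_sum_bernoulli_smul_le hp hpq ha hind _
    _ = R * (Fintype.card (Inc m n) * L) := by
        rw [lintegral_const_mul _ (Finset.measurable_fun_sum _ fun i _ => hmeas i),
          lintegral_finsetSum _ fun i _ => hmeas i]
        simp only [hmom]
        simp
    _ = c * ((4 * (c * c)) ^ (q / p) * (ENNReal.ofReal pn ^ (q / p) *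
          ((Fintype.card (Inc m n) : ℝ≥0∞) ^ (q / p - 1) * (Fintype.card (Inc m n) : ℝ≥0∞))) +
          4 * (c * c) * (ENNReal.ofReal pn * (Fintype.card (Inc m n) : ℝ≥0∞))) * L := by
        rw [hR]; ring
    _ ≤ _ := by gcongr

/-- Moment bound for the incomplete `U`-statistic, for `n ≥ 1`. -/
lemma IsPotential.lintegral_enorm_incompleteUStat_le (hΦ : IsPotential p q Φ c) (hp : 1 < p)
    (hpq : p ≤ q) (hξ : IsIID μ ξ) (hh : Measurable h) (hn : 1 ≤ n) {d : ℕ} {K : ℝ≥0∞}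
    (hK : ∫⁻ x, ‖kernelSum m n h x‖ₑ ^ q ∂(Measure.pi fun _ => μ.map (ξ 1)) ≤
      K * (n : ℝ≥0∞) ^ (q * ((m : ℝ) - d) + d * q / p) *
        ∫⁻ y, ‖h y‖ₑ ^ q ∂(Measure.pi fun _ => μ.map (ξ 1)))
    (ha : ∀ i, HasLaw (a i) (bernoulliMeasure (1 : ℝ) 0 pn) μ) (hind : iIndepFun a μ)
    (hindξ : IndepFun (fun ω i => a i ω) (fun ω (j : {j : ℤ // 1 ≤ j}) => ξ j ω) μ) :
    ∫⁻ ω, ‖incompleteUStat a ξ h ω‖ₑ ^ q ∂μ ≤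
      2 ^ (q - 1) * (K + c * (4 * (c * c)) ^ (q / p) + c * (4 * (c * c))) *
        ((n : ℝ≥0∞) ^ (q * ((m : ℝ) - d) + d * q / p) * ENNReal.ofReal pn ^ q +
          (n : ℝ≥0∞) ^ (m * q / p) * ENNReal.ofReal pn ^ (q / p) +
          (n : ℝ≥0∞) ^ m * ENNReal.ofReal pn) *
        ∫⁻ ω, ‖h (firstVec ξ m ω)‖ₑ ^ q ∂μ := by
  have hq0 : 0 ≤ q := by linarith
  have h2 := hΦ.lintegral_enorm_centered_part_le hp hpq hξ hh hn ha hind hindξ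
  set L := ∫⁻ ω, ‖h (firstVec ξ m ω)‖ₑ ^ q ∂μ with hL
  have hLpi : ∫⁻ y, ‖h y‖ₑ ^ q ∂(Measure.pi fun _ => μ.map (ξ 1)) = L :=
    (hξ.lintegral_enorm_comp_rpow hh (injective_firstVec_index m)).symm
  have hVm := measurable_kernelSum (n := n) hh
  have hfm : Measurable (firstVec ξ n) := measurable_pi_lambda _ fun k => hξ.1 _
  have h1 : ∫⁻ ω, ‖(pn : ℝ) • kernelSum m n h (firstVec ξ n ω)‖ₑ ^ q ∂μ ≤
      ENNReal.ofReal pn ^ q * (K * (n : ℝ≥0∞) ^ (q * ((m : ℝ) - d) + d * q / p) * L) := by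
    have e : ∫⁻ ω, ‖kernelSum m n h (firstVec ξ n ω)‖ₑ ^ q ∂μ =
        ∫⁻ x, ‖kernelSum m n h x‖ₑ ^ q ∂(Measure.pi fun _ => μ.map (ξ 1)) := by
      rw [← hξ.map_eq_pi (injective_firstVec_index n)]
      exact (lintegral_map (hVm.enorm.pow_const q) hfm).symm
    have ep : ‖(pn : ℝ)‖ₑ = ENNReal.ofReal pn := by
      rw [← ofReal_norm, Real.norm_of_nonneg pn.2.1]
    simp only [enorm_smul, ENNReal.mul_rpow_of_nonneg _ _ hq0, ep]
    rw [lintegral_const_mul' _ _ (ENNReal.rpow_ne_top_of_nonneg hq0 (by simp)), e]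
    rw [hLpi] at hK
    gcongr
  set T₁ := (n : ℝ≥0∞) ^ (q * ((m : ℝ) - d) + d * q / p) * ENNReal.ofReal pn ^ q with hT₁
  set T₂ := (n : ℝ≥0∞) ^ (m * q / p) * ENNReal.ofReal pn ^ (q / p) with hT₂
  set T₃ := (n : ℝ≥0∞) ^ m * ENNReal.ofReal pn with hT₃
  have hm1 : Measurable fun ω => ‖(pn : ℝ) • kernelSum m n h (firstVec ξ n ω)‖ₑ ^ q :=
    ((hVm.comp hfm).const_smul (pn : ℝ)).enorm.pow_const q
  calc _ ≤ ∫⁻ ω, 2 ^ (q - 1) * (‖(pn : ℝ) • kernelSum m n h (firstVec ξ n ω)‖ₑ ^ q +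
        ‖∑ i : Inc m n, (a i ω - pn) • h (fun k => ξ (i.1 k) ω)‖ₑ ^ q) ∂μ := by
        refine lintegral_mono fun ω => ?_
        rw [incompleteUStat_eq a ξ h pn]
        exact enorm_add_rpow_le (hp.le.trans hpq) _ _
    _ = 2 ^ (q - 1) * (∫⁻ ω, ‖(pn : ℝ) • kernelSum m n h (firstVec ξ n ω)‖ₑ ^ q ∂μ +
        ∫⁻ ω, ‖∑ i : Inc m n, (a i ω - pn) • h (fun k => ξ (i.1 k) ω)‖ₑ ^ q ∂μ) := by
        rw [lintegral_const_mul' _ _ (ENNReal.rpow_ne_top_of_nonneg (by linarith) (by simp)),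
          lintegral_add_left hm1]
    _ ≤ 2 ^ (q - 1) * (ENNReal.ofReal pn ^ q *
          (K * (n : ℝ≥0∞) ^ (q * ((m : ℝ) - d) + d * q / p) * L) +
        c * ((4 * (c * c)) ^ (q / p) * (ENNReal.ofReal pn ^ (q / p) * (n : ℝ≥0∞) ^ (m * q / p)) +
          4 * (c * c) * (ENNReal.ofReal pn * (n : ℝ≥0∞) ^ m)) * L) := by gcongr
    _ = 2 ^ (q - 1) * (K * T₁ + c * (4 * (c * c)) ^ (q / p) * T₂ + c * (4 * (c * c)) * T₃) * L := by
        rw [hT₁, hT₂, hT₃]; ring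
    _ ≤ 2 ^ (q - 1) * (K * (T₁ + T₂ + T₃) + c * (4 * (c * c)) ^ (q / p) * (T₁ + T₂ + T₃) +
          c * (4 * (c * c)) * (T₁ + T₂ + T₃)) * L := by
        gcongr
        · exact le_add_right le_self_add
        · exact le_add_right le_add_self
        · exact le_add_self
    _ = _ := by ring

end IncompleteUStat

/-! ### Conversion to real constants and conclusion -/

namespace IncompleteUStat

open scoped ENNReal NNReal

lemma ofReal_const_mul_bound {C : ℝ≥0∞} (hC : C ≠ ∞) {n : ℕ} {pn : ℝ}
    (hpn : 0 ≤ pn) (hn : 1 ≤ n) {e q s : ℝ} (hq : 0 ≤ q) (hs : 0 ≤ s) (t : ℝ) (m : ℕ) :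
    ENNReal.ofReal (C.toReal * ((n : ℝ) ^ e * pn ^ q + (n : ℝ) ^ t * pn ^ s + (n : ℝ) ^ m * pn)) =
      C * ((n : ℝ≥0∞) ^ e * ENNReal.ofReal pn ^ q + (n : ℝ≥0∞) ^ t * ENNReal.ofReal pn ^ s +
        (n : ℝ≥0∞) ^ m * ENNReal.ofReal pn) := by
  have hn0 : (0 : ℝ) < n := by exact_mod_cast hn
  rw [ENNReal.ofReal_mul ENNReal.toReal_nonneg, ENNReal.ofReal_toReal hC,
    ENNReal.ofReal_add (by positivity) (by positivity),
    ENNReal.ofReal_add (by positivity) (by positivity), ENNReal.ofReal_mul (by positivity),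
    ENNReal.ofReal_mul (by positivity), ENNReal.ofReal_mul (by positivity),
    ENNReal.ofReal_rpow_of_nonneg hpn hq, ENNReal.ofReal_rpow_of_nonneg hpn hs,
    ← ENNReal.ofReal_rpow_of_pos hn0, ← ENNReal.ofReal_rpow_of_pos hn0,
    ENNReal.ofReal_pow hn0.le, ENNReal.ofReal_natCast]

end IncompleteUStat

theorem mainTheorem8
    {B : Type*} [NormedAddCommGroup B] [NormedSpace ℝ B] [CompleteSpace B]
    [TopologicalSpace.SeparableSpace B] [MeasurableSpace B] [BorelSpace B]
    (m : ℕ) (hm : 2 ≤ m) (p q : ℝ) (hp : 1 < p) (hpq : p ≤ q) :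
    ∃ C : ℝ, 0 < C ∧
      ∀ (r : ℝ), p ≤ r → r ≤ 2 → IncompleteUStat.IsSmoothSpace r B →
      ∀ {Ω S : Type*} [MeasurableSpace Ω] [MeasurableSpace S]
        (μ : Measure Ω) [IsProbabilityMeasure μ]
        (ξ : ℤ → Ω → S), IncompleteUStat.IsIID μ ξ →
      ∀ (h : (Fin m → S) → B), Measurable h → IncompleteUStat.IsSymmKernel h →
      ∀ (d : ℕ), 1 ≤ d → d ≤ m → IncompleteUStat.IsDegenerateOfOrder μ ξ h d →
      ∀ (n : ℕ) (pn : unitInterval) (a : IncompleteUStat.Inc m n → Ω → ℝ),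
        (∀ i, HasLaw (a i) (bernoulliMeasure (1 : ℝ) 0 pn) μ) →
        iIndepFun a μ →
        IndepFun (fun ω i => a i ω) (fun ω (j : {j : ℤ // 1 ≤ j}) => ξ j ω) μ →
        ∫⁻ ω, ‖IncompleteUStat.incompleteUStat a ξ h ω‖ₑ ^ q ∂μ ≤
          ENNReal.ofReal
            (C * ((n : ℝ) ^ (q * ((m : ℝ) - d) + d * q / p) * (pn : ℝ) ^ q
              + (n : ℝ) ^ (m * q / p) * (pn : ℝ) ^ (q / p)
              + (n : ℝ) ^ m * (pn : ℝ)))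
          * ∫⁻ ω, ‖h (IncompleteUStat.firstVec ξ m ω)‖ₑ ^ q ∂μ := by
  have : SecondCountableTopology B := UniformSpace.secondCountable_of_separable B
  have hp0 : 0 < p := by linarith
  have hq0 : 0 < q := by linarith
  -- The constant is fixed before `r`: if some admissible exponent exists, one such `r₀` supplies
  -- the potential, and otherwise there is nothing to prove.
  by_cases hex : ∃ r : ℝ, p ≤ r ∧ r ≤ 2 ∧ IncompleteUStat.IsSmoothSpace r B
  swap
  · exact ⟨1, one_pos, fun r h1 h2 h3 => absurd ⟨r, h1, h2, h3⟩ hex⟩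
  obtain ⟨r₀, hpr, hr, hsmooth⟩ := hex
  obtain ⟨Φ, c, hΦ⟩ := hsmooth.exists_isPotential hp hpr hr hpq
  choose K hKtop hK1 hK using hΦ.exists_lintegral_enorm_kernelSum_rpow_le hp hpq m
  -- Summing over all `d ≤ m` makes the constant independent of `d`.
  set κ := ∑ d ∈ Finset.range (m + 1), K d with hκ
  have hκtop : κ ≠ ⊤ := ENNReal.sum_ne_top.2 fun d _ => hKtop d
  have hκ1 : 1 ≤ κ := (hK1 0).trans
    (Finset.single_le_sum (f := K) (fun _ _ => zero_le) (Finset.mem_range.2 (Nat.succ_pos m)))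
  set C := 2 ^ (q - 1) * (κ + c * (4 * (c * c)) ^ (q / p) + c * (4 * (c * c))) with hC
  have h4 : 4 * (c * c) ≠ ⊤ :=
    ENNReal.mul_ne_top (by simp) (ENNReal.mul_ne_top hΦ.ne_top hΦ.ne_top)
  have hCtop : C ≠ ⊤ :=
    ENNReal.mul_ne_top (ENNReal.rpow_ne_top_of_nonneg (by linarith) (by simp))
      (ENNReal.add_ne_top.2 ⟨ENNReal.add_ne_top.2 ⟨hκtop, ENNReal.mul_ne_top hΦ.ne_top
        (ENNReal.rpow_ne_top_of_nonneg (by positivity) h4)⟩, ENNReal.mul_ne_top hΦ.ne_top h4⟩)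
  have hC0 : C ≠ 0 := by
    refine mul_ne_zero (ENNReal.rpow_pos (by simp) (by simp)).ne' ?_
    have h0 : κ ≠ 0 := (zero_lt_one.trans_le hκ1).ne'
    simp [h0]
  refine ⟨C.toReal, ENNReal.toReal_pos hC0 hCtop, ?_⟩
  intro r _ _ _ Ω S _ _ μ _ ξ hξ h hh hsymm d hd1 hdm hdeg n pn a ha hind hindξ
  -- For `n = 0` there are no tuples because `m ≥ 2`, and the statistic vanishes; from then on `n ≥
  -- 1` makes real and extended powers of `n` agree for any exponent.
  rcases Nat.eq_zero_or_pos n with rfl | hn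
  · have hempty : IsEmpty (IncompleteUStat.Inc m 0) := by
      rw [← Fintype.card_eq_zero_iff, Fintype.card_coe]
      have := IncompleteUStat.card_Inc_le m 0
      rwa [zero_pow (by omega), Nat.le_zero] at this
    simp [IncompleteUStat.incompleteUStat, ENNReal.zero_rpow_of_pos hq0]
  have := hξ.isProbabilityMeasure_map
  have hker := hK d (μ.map (ξ 1)) h hh (hξ.degenerateKernel hd1 hdm hh hsymm hdeg) n n hn le_rfl
  have hKd : K d ≤ κ := Finset.single_le_sum (f := K) (fun _ _ => zero_le)
    (Finset.mem_range.2 (by omega))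
  rw [IncompleteUStat.ofReal_const_mul_bound hCtop pn.2.1 hn hq0.le (by positivity)]
  exact hΦ.lintegral_enorm_incompleteUStat_le hp hpq hξ hh hn
    (hker.trans (by gcongr)) ha hind hindξ
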